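/- **Setting.** Fix a separable infinite-dimensional complex Hilbert space $L$ and a unitary isomorphism $\iota: L\hat\otimes_{\rm Hilb} L\to L$. Let $\mathcal B=\mathcal B(L)$ and let $\mathcal K$ be the ideal of finite rank operators in $\mathcal B$; for $a,b\in\mathcal B$ put $a\diamond b:=\iota(a\otimes b)\iota^{-1}$. For a complex linear space $E$ put $\mathcal KE:=\mathcal K\otimes E$, a $\mathcal B$-bimodule with $a\cdot(cx)\cdot b=(acb)x$, where $cx:=c\otimes x$. A semi-normed $PQ$-space is a space $E$ with a semi-norm on $\mathcal KE$ such that $\|a\cdot u\cdot b\|\le\|a\|\,\|u\|\,\|b\|$ for all $a,b\in\mathcal B$, $u\in\mathcal KE$; its underlying semi-norm is $\|x\|:=\|Qx\|$, with $Q$ any operator of rank one and norm one, and it is called a $PQ$-space if this is a norm (then so is the semi-norm on $\mathcal KE$). A linear operator $\varphi:E\to F$ is completely isometric if $\varphi_\infty=\mathrm{id}_{\mathcal K}\otimes\varphi:\mathcal KE\to\mathcal KF$ is isometric. * $\overline E$ is the completion of the underlying space, with the norm on $\mathcal K\overline E$ induced by the natural map $\mathcal K\overline E\to\overline{\mathcal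 KE}$. * $E\otimes_{pop}F$ is $E\otimes F$ with $\|U\|_{pop}=\inf\sum_{k=1}^n\|a_k\|\|u_k\|\|v_k\|\|b_k\|$, the infimum over all representations $U=\sum_{k=1}^n a_k\cdot(u_k\diamond v_k)\cdot b_k$ with $a_k,b_k\in\mathcal B$, $u_k\in\mathcal KE$, $v_k\in\mathcal KF$, where $ax\diamond by:=(a\diamond b)(x\otimes y)$; and $E\hat\otimes_{pop}F:=\overline{E\otimes_{pop}F}$. * For a measure space $(X,\mu)$ and a $PQ$-space $E$, the space $L_1(X,E)$ of (classes of) strongly measurable integrable functions is a $PQ$-space, the norm of $u\in\mathcal K(L_1(X,E))$ being that of the corresponding function in $L_1(X,\mathcal KE)$. **Theorem 6.9.** Let $(X,\mu)$, $(Y,\nu)$ be arbitrary measure spaces, let $X\times Y$ carry the product measure (the Carathéodory extension of $A\times B\mapsto\mu(A)\nu(B)$, restricted to the product $\sigma$-algebra), and let $E,F$ be $PQ$-spaces. Then there is exactly one completely isometric linear isomorphism $$I:L_1(X,E)\hat\otimes_{pop}L_1(Y,F)\to L_1(X\times Y,E\hat\otimes_{pop}F)$$ such that, for all $x\in L_1(X,E)$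 and $y\in L_1(Y,F)$, $I(x\otimes y)$ is the class of the function $(s,t)\mapsto x(s)\otimes y(t)$. -/

import Mathlib

open scoped TensorProduct ENNReal
open MeasureTheory UniformSpace

noncomputable section

namespace PQ

/-! ### Finite rank operators and amplifications -/

section FiniteRank

variable (L : Type*) [NormedAddCommGroup L] [InnerProductSpace ℂ L]

/-- The (non-closed) two-sided ideal of bounded operators of finite rank on `L`. -/
def finRank : Submodule ℂ (L →L[ℂ] L) where
  carrier := {a | FiniteDimensional ℂ (LinearMap.range (a : L →ₗ[ℂ] L))}
  zero_mem' := by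
    change FiniteDimensional ℂ (LinearMap.range (0 : L →ₗ[ℂ] L))
    rw [LinearMap.range_zero]; infer_instance
  add_mem' := by
    intro a b ha hb
    have ha' : FiniteDimensional ℂ (LinearMap.range (a : L →ₗ[ℂ] L)) := ha
    have hb' : FiniteDimensional ℂ (LinearMap.range (b : L →ₗ[ℂ] L)) := hb
    exact Submodule.finiteDimensional_of_le
      (LinearMap.range_add_le (a : L →ₗ[ℂ] L) (b : L →ₗ[ℂ] L))
  smul_mem' := by
    intro c a ha
    have ha' : FiniteDimensional ℂ (LinearMap.range (a : L →ₗ[ℂ] L)) := ha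
    refine Submodule.finiteDimensional_of_le (S₂ := LinearMap.range (a : L →ₗ[ℂ] L)) ?_
    rintro _ ⟨x, rfl⟩
    exact ⟨c • x, by simp⟩

/-- The linear space `K` of finite rank operators on `L`. -/
def FinRank : Type _ := finRank L

instance : AddCommGroup (FinRank L) := inferInstanceAs (AddCommGroup (finRank L))
instance : Module ℂ (FinRank L) := inferInstanceAs (Module ℂ (finRank L))

variable {L}

theorem mem_finRank {a : L →L[ℂ] L} :
    a ∈ finRank L ↔ FiniteDimensional ℂ (LinearMap.range (a : L →ₗ[ℂ] L)) := Iff.rfl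

theorem comp_mem_finRank (a b c : L →L[ℂ] L) (hc : c ∈ finRank L) :
    a ∘L c ∘L b ∈ finRank L := by
  rw [mem_finRank] at hc ⊢
  refine Submodule.finiteDimensional_of_le
    (S₂ := (LinearMap.range (c : L →ₗ[ℂ] L)).map (a : L →ₗ[ℂ] L)) ?_
  rintro _ ⟨x, rfl⟩
  exact ⟨c (b x), ⟨b x, rfl⟩, rfl⟩

/-- A finite rank operator as a bounded operator. -/
def FinRank.toCLM : FinRank L →ₗ[ℂ] L →L[ℂ] L := (finRank L).subtype

theorem FinRank.toCLM_injective : Function.Injective (FinRank.toCLM (L := L)) :=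
  Subtype.val_injective

@[ext] theorem FinRank.ext {a b : FinRank L} (h : ∀ ξ, a.toCLM ξ = b.toCLM ξ) : a = b :=
  FinRank.toCLM_injective (ContinuousLinearMap.ext h)

/-- `c ↦ a c b` on finite rank operators. -/
def biMul (a b : L →L[ℂ] L) : FinRank L →ₗ[ℂ] FinRank L where
  toFun c := ⟨a ∘L c.toCLM ∘L b, comp_mem_finRank a b c.toCLM c.2⟩
  map_add' c d := by
    apply Subtype.ext
    change a ∘L (c + d).toCLM ∘L b = a ∘L c.toCLM ∘L b + a ∘L d.toCLM ∘L b
    ext x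
    simp
  map_smul' r c := by
    apply Subtype.ext
    change a ∘L (r • c).toCLM ∘L b = r • (a ∘L c.toCLM ∘L b)
    ext x
    simp

@[simp] theorem toCLM_biMul (a b : L →L[ℂ] L) (c : FinRank L) :
    (biMul a b c).toCLM = a ∘L c.toCLM ∘L b := rfl

/-- The rank one operator `ζ ↦ ⟨ζ, η⟩ ξ` (inner product linear in `ζ`). -/
def rankOne (ξ η : L) : FinRank L :=
  ⟨InnerProductSpace.rankOne ℂ ξ η, by
    rw [mem_finRank]
    refine Submodule.finiteDimensional_of_le (S₂ := Submodule.span ℂ {ξ}) ?_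
    rintro _ ⟨x, rfl⟩
    exact Submodule.mem_span_singleton.2 ⟨inner ℂ η x, by simp⟩⟩

@[simp] theorem toCLM_rankOne (ξ η : L) :
    (rankOne ξ η).toCLM = InnerProductSpace.rankOne ℂ ξ η := rfl

theorem biMul_rankOne (ξ η ξ' η' : L) (c : FinRank L) :
    biMul (rankOne ξ η).toCLM (rankOne ξ' η').toCLM c =
      inner ℂ η (c.toCLM ξ') • rankOne ξ η' := by
  ext z
  simp [smul_smul, mul_comm]

theorem finRank_eq_sum [CompleteSpace L] (a : FinRank L) :
    ∃ (n : ℕ) (ξ η : Fin n → L), a = ∑ i, rankOne (ξ i) (η i) := by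
  have ha : FiniteDimensional ℂ (LinearMap.range (a.toCLM : L →ₗ[ℂ] L)) := a.2
  let b := stdOrthonormalBasis ℂ (LinearMap.range (a.toCLM : L →ₗ[ℂ] L))
  refine ⟨_, fun i => (b i : L), fun i => ContinuousLinearMap.adjoint a.toCLM (b i), ?_⟩
  ext z
  have h := congrArg Subtype.val (b.sum_repr' ⟨a.toCLM z, LinearMap.mem_range_self _ z⟩)
  simp only [Submodule.coe_sum, Submodule.coe_smul, Submodule.coe_inner] at h
  simp [ContinuousLinearMap.adjoint_inner_left, h]

end FiniteRank

/-! ### Amplifications -/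

section Amplification

/-- The amplification `K ⊗ E` of a linear space `E`. -/
def Amp (L : Type*) [NormedAddCommGroup L] [InnerProductSpace ℂ L]
    (E : Type*) [AddCommGroup E] [Module ℂ E] : Type _ := FinRank L ⊗[ℂ] E

variable {L : Type*} [NormedAddCommGroup L] [InnerProductSpace ℂ L]
  {E F G : Type*} [AddCommGroup E] [Module ℂ E] [AddCommGroup F] [Module ℂ F]
  [AddCommGroup G] [Module ℂ G]

instance : AddCommGroup (Amp L E) := inferInstanceAs (AddCommGroup (FinRank L ⊗[ℂ] E))
instance : Module ℂ (Amp L E) := inferInstanceAs (Module ℂ (FinRank L ⊗[ℂ] E))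

/-- The elementary tensor `a x`. -/
def elem : FinRank L →ₗ[ℂ] E →ₗ[ℂ] Amp L E := TensorProduct.mk ℂ (FinRank L) E

theorem Amp.induction_on {P : Amp L E → Prop} (u : Amp L E) (zero : P 0)
    (elem : ∀ a x, P (elem a x)) (add : ∀ u v, P u → P v → P (u + v)) : P u :=
  TensorProduct.induction_on u zero elem add

/-- The linear map on the amplification given by a bilinear map. -/
def ampLift (f : FinRank L →ₗ[ℂ] E →ₗ[ℂ] G) : Amp L E →ₗ[ℂ] G := TensorProduct.lift f

@[simp] theorem ampLift_elem (f : FinRank L →ₗ[ℂ] E →ₗ[ℂ] G) (a : FinRank L) (x : E) :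
    ampLift f (elem a x) = f a x := TensorProduct.lift.tmul a x

/-- The amplification `a x ↦ a φ(x)` of a linear operator `φ`. -/
def ampMap (L : Type*) [NormedAddCommGroup L] [InnerProductSpace ℂ L] (φ : E →ₗ[ℂ] F) :
    Amp L E →ₗ[ℂ] Amp L F := φ.lTensor (FinRank L)

@[simp] theorem ampMap_elem (φ : E →ₗ[ℂ] F) (a : FinRank L) (x : E) :
    ampMap L φ (elem a x) = elem a (φ x) := rfl

/-- The outer multiplications `u ↦ a · u · b` on the amplification of `E`. -/
def ampMul (a b : L →L[ℂ] L) : Amp L E →ₗ[ℂ] Amp L E := (biMul a b).rTensor E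

@[simp] theorem ampMul_elem (a b : L →L[ℂ] L) (c : FinRank L) (x : E) :
    ampMul a b (elem c x) = elem (biMul a b c) x := rfl

theorem ampMul_ampMul (a a' b' b : L →L[ℂ] L) (u : Amp L E) :
    ampMul a b (ampMul a' b' u) = ampMul (a ∘L a') (b' ∘L b) u := by
  induction u using Amp.induction_on with
  | zero => simp
  | add x y hx hy => simp only [map_add, hx, hy]
  | elem c x => rfl

/-- The matrix coefficient `c x ↦ ⟨c ξ, η⟩ x`. -/
def coeff (E : Type*) [AddCommGroup E] [Module ℂ E] (η ξ : L) : Amp L E →ₗ[ℂ] E :=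
  ampLift <| LinearMap.mk₂ ℂ (fun c x => inner ℂ η (c.toCLM ξ) • x)
    (fun c d x => by simp [add_smul])
    (fun r c x => by simp [smul_smul])
    (fun c x y => by simp)
    (fun r c x => smul_comm _ _ _)

@[simp] theorem coeff_elem (η ξ : L) (c : FinRank L) (x : E) :
    coeff E η ξ (elem c x) = inner ℂ η (c.toCLM ξ) • x := by simp [coeff]

theorem ampMul_rankOne (ξ η ξ' η' : L) (u : Amp L E) :
    ampMul (rankOne ξ η).toCLM (rankOne ξ' η').toCLM u =
      elem (rankOne ξ η') (coeff E η ξ' u) := by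
  induction u using Amp.induction_on with
  | zero => simp
  | add x y hx hy => simp only [map_add, hx, hy]
  | elem c x => rw [ampMul_elem, biMul_rankOne, coeff_elem, map_smul, map_smul,
      LinearMap.smul_apply]

theorem eq_zero_of_coeff (u : Amp L E) (h : ∀ η ξ : L, coeff E η ξ u = 0) : u = 0 := by
  classical
  let b := Module.Basis.ofVectorSpace ℂ E
  let T : Amp L E ≃ₗ[ℂ] _ := TensorProduct.equivFinsuppOfBasisRight (M := FinRank L) b
  apply T.injective
  ext i : 1
  rw [LinearEquiv.map_zero, Finsupp.zero_apply]
  have key : ∀ (η ξ : L) (u : Amp L E),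
      inner ℂ η ((T u i).toCLM ξ) = b.repr (coeff E η ξ u) i := by
    intro η ξ u
    induction u using Amp.induction_on with
    | zero => simp
    | add x y hx hy =>
      rw [LinearEquiv.map_add, Finsupp.add_apply, map_add, add_apply, inner_add_right, hx, hy,
        map_add, LinearEquiv.map_add, Finsupp.add_apply]
    | elem c x =>
      have : T (elem c x) i = b.repr x i • c :=
        TensorProduct.equivFinsuppOfBasisRight_apply_tmul_apply b c x i
      rw [this]
      simp [mul_comm]
  ext ξ
  refine ext_inner_left ℂ fun η => ?_
  rw [key, h]
  simp

end Amplification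

/-! ### Proto-quantum spaces -/

/-- A proto-quantum structure on a semi-normed space `E`: a semi-norm `pq` on the amplification
that makes it a contractive bimodule over the bounded operators on `L`, and whose underlying
semi-norm `x ↦ pq (Q x)`, with `Q` of rank one and norm one, is the given semi-norm of `E`.
If `E` is normed then `pq` is a norm; see `PQ.eq_zero_of_pq_eq_zero` below. -/
class PQSpace (L : Type*) [NormedAddCommGroup L] [InnerProductSpace ℂ L]
    (E : Type*) [SeminormedAddCommGroup E] [NormedSpace ℂ E] where
  pq : Seminorm ℂ (Amp L E)
  pq_ampMul_le : ∀ (a b : L →L[ℂ] L) (u : Amp L E), pq (ampMul a b u) ≤ ‖a‖ * pq u * ‖b‖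
  pq_rankOne : ∀ (ξ η : L), ‖ξ‖ = 1 → ‖η‖ = 1 → ∀ x : E, pq (elem (rankOne ξ η) x) = ‖x‖

variable {L : Type*} [NormedAddCommGroup L] [InnerProductSpace ℂ L]

theorem exists_unit (L : Type*) [NormedAddCommGroup L] [InnerProductSpace ℂ L] [Nontrivial L] :
    ∃ e : L, ‖e‖ = 1 := by
  obtain ⟨x, hx⟩ := exists_ne (0 : L)
  exact ⟨((‖x‖⁻¹ : ℝ) : ℂ) • x, by simp [norm_smul, hx]⟩

theorem eq_zero_of_pq_eq_zero [Nontrivial L] {E : Type*} [NormedAddCommGroup E]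
    [NormedSpace ℂ E] [PQSpace L E] (u : Amp L E) (hu : PQSpace.pq u = 0) : u = 0 := by
  obtain ⟨e, he⟩ := exists_unit L
  refine eq_zero_of_coeff u fun η ξ => ?_
  have h := PQSpace.pq_ampMul_le (rankOne e η).toCLM (rankOne ξ e).toCLM u
  rw [ampMul_rankOne, PQSpace.pq_rankOne _ _ he he, hu] at h
  simpa using h

section AmpNorm

variable {E : Type*} [SeminormedAddCommGroup E] [NormedSpace ℂ E] [PQSpace L E]

/-- The amplification of a semi-normed proto-quantum space is a semi-normed space. -/
instance : SeminormedAddCommGroup (Amp L E) :=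
  (PQSpace.pq (L := L) (E := E)).toAddGroupSeminorm.toSeminormedAddCommGroup

theorem norm_eq_pq (u : Amp L E) : ‖u‖ = PQSpace.pq u := rfl

instance : NormedSpace ℂ (Amp L E) where
  norm_smul_le c u := (map_smul_eq_mul (PQSpace.pq (L := L) (E := E)) c u).le

/-- The outer multiplications as bounded operators. -/
def ampMulL (E : Type*) [SeminormedAddCommGroup E] [NormedSpace ℂ E] [PQSpace L E]
    (a b : L →L[ℂ] L) : Amp L E →L[ℂ] Amp L E :=
  LinearMap.mkContinuous (ampMul a b) (‖a‖ * ‖b‖) fun u =>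
    (PQSpace.pq_ampMul_le a b u).trans_eq (by rw [norm_eq_pq]; ring)

theorem norm_ampMulL_le (a b : L →L[ℂ] L) : ‖ampMulL E a b‖ ≤ ‖a‖ * ‖b‖ :=
  LinearMap.mkContinuous_norm_le _ (by positivity) _

@[simp] theorem ampMulL_elem (a b : L →L[ℂ] L) (c : FinRank L) (x : E) :
    ampMulL E a b (elem c x) = elem (biMul a b c) x := rfl

end AmpNorm

/-- The amplification of a normed proto-quantum space is a normed space. -/
instance {E : Type*} [NormedAddCommGroup E] [NormedSpace ℂ E] [PQSpace L E] [Nontrivial L] :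
    NormedAddCommGroup (Amp L E) :=
  { (inferInstance : SeminormedAddCommGroup (Amp L E)) with
    eq_of_dist_eq_zero := by
      intro u v h
      rw [dist_eq_norm] at h
      exact sub_eq_zero.1 (eq_zero_of_pq_eq_zero _ h) }

section Completion

variable [Nontrivial L] {E : Type*} [SeminormedAddCommGroup E] [NormedSpace ℂ E] [PQSpace L E]

theorem pq_rankOne_le (ξ η : L) (x : E) : ‖elem (rankOne ξ η) x‖ ≤ ‖ξ‖ * ‖η‖ * ‖x‖ := by
  obtain ⟨e, he⟩ := exists_unit L
  have h := PQSpace.pq_ampMul_le (rankOne ξ e).toCLM (rankOne e η).toCLM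
    (elem (rankOne e e) x)
  rw [ampMul_rankOne, PQSpace.pq_rankOne _ _ he he] at h
  simpa [he, mul_right_comm, norm_eq_pq] using h

variable [CompleteSpace L]

theorem exists_bound (a : FinRank L) : ∃ C : ℝ, ∀ x : E, ‖elem a x‖ ≤ C * ‖x‖ := by
  obtain ⟨n, ξ, η, rfl⟩ := finRank_eq_sum a
  refine ⟨∑ i, ‖ξ i‖ * ‖η i‖, fun x => ?_⟩
  rw [map_sum, LinearMap.sum_apply, Finset.sum_mul]
  exact (norm_sum_le _ _).trans (Finset.sum_le_sum fun i _ => pq_rankOne_le _ _ _)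

/-- The bounded operator `x ↦ a x`. -/
def tmulL (E : Type*) [SeminormedAddCommGroup E] [NormedSpace ℂ E] [PQSpace L E]
    (a : FinRank L) : E →L[ℂ] Amp L E :=
  LinearMap.mkContinuousOfExistsBound (elem a) (exists_bound a)

@[simp] theorem tmulL_apply (a : FinRank L) (x : E) : tmulL E a x = elem a x := rfl

theorem completion_tmulL_add (a b : FinRank L) (z : Completion E) :
    (tmulL E (a + b)).completion z = (tmulL E a).completion z + (tmulL E b).completion z :=
  congrFun (Completion.ext (ContinuousLinearMap.continuous _)
    ((ContinuousLinearMap.continuous _).add (ContinuousLinearMap.continuous _)) fun x => by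
      rw [Pi.add_apply, ContinuousLinearMap.completion_apply_coe,
        ContinuousLinearMap.completion_apply_coe, ContinuousLinearMap.completion_apply_coe, ← Completion.coe_add]
      simp only [tmulL_apply, map_add, LinearMap.add_apply]) z

theorem completion_tmulL_smul (c : ℂ) (a : FinRank L) (z : Completion E) :
    (tmulL E (c • a)).completion z = c • (tmulL E a).completion z :=
  congrFun (Completion.ext (ContinuousLinearMap.continuous _)
    ((ContinuousLinearMap.continuous _).const_smul c) fun x => by
      rw [Pi.smul_apply, ContinuousLinearMap.completion_apply_coe,
        ContinuousLinearMap.completion_apply_coe, ← Completion.coe_smul]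
      simp only [tmulL_apply, map_smul, LinearMap.smul_apply]) z

/-- The natural map of the amplification of the completion of `E` into the completion of the
amplification of `E`, extending `a x ↦ a x`. -/
def amplCompl (L : Type*) [NormedAddCommGroup L] [InnerProductSpace ℂ L] [Nontrivial L]
    [CompleteSpace L] (E : Type*) [SeminormedAddCommGroup E] [NormedSpace ℂ E] [PQSpace L E] :
    Amp L (Completion E) →ₗ[ℂ] Completion (Amp L E) :=
  ampLift <| LinearMap.mk₂ ℂ (fun a z => (tmulL E a).completion z)
    completion_tmulL_add completion_tmulL_smul
    (fun _ z w => ContinuousLinearMap.map_add _ z w)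
    (fun c _ z => ContinuousLinearMap.map_smul _ c z)

theorem amplCompl_tmul (a : FinRank L) (z : Completion E) :
    amplCompl L E (elem a z) = (tmulL E a).completion z := rfl

theorem amplCompl_ampMul (a b : L →L[ℂ] L) (u : Amp L (Completion E)) :
    amplCompl L E (ampMul a b u) = (ampMulL E a b).completion (amplCompl L E u) := by
  induction u using Amp.induction_on with
  | zero => simp
  | add u v hu hv => simp only [map_add, hu, hv]
  | elem c z =>
    rw [ampMul_elem, amplCompl_tmul, amplCompl_tmul]
    induction z using Completion.induction_on with
    | hp => exact isClosed_eq (by fun_prop) (by fun_prop)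
    | ih x => simp

/-- The completion of a proto-quantum space: the norm on the amplification of the completion of `E`
is induced from the completion of the amplification of `E`. -/
instance : PQSpace L (Completion E) where
  pq := (normSeminorm ℂ (Completion (Amp L E))).comp (amplCompl L E)
  pq_ampMul_le a b u := by
    simp only [Seminorm.comp_apply, coe_normSeminorm, amplCompl_ampMul]
    refine ((ampMulL E a b).completion.le_of_opNorm_le (c := ‖a‖ * ‖b‖) ?_ _).trans_eq (by ring)
    refine ContinuousLinearMap.opNorm_le_bound _ (by positivity) fun z => ?_
    induction z using Completion.induction_on with
    | hp => exact isClosed_le (by fun_prop) (by fun_prop)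
    | ih x =>
      rw [ContinuousLinearMap.completion_apply_coe, Completion.norm_coe, Completion.norm_coe]
      exact (ampMulL E a b).le_of_opNorm_le (norm_ampMulL_le a b) x
  pq_rankOne ξ η hξ hη z := by
    simp only [Seminorm.comp_apply, coe_normSeminorm, amplCompl_tmul]
    induction z using Completion.induction_on with
    | hp => exact isClosed_eq (by fun_prop) (by fun_prop)
    | ih x =>
      rw [ContinuousLinearMap.completion_apply_coe, Completion.norm_coe, Completion.norm_coe,
        tmulL_apply, norm_eq_pq, PQSpace.pq_rankOne ξ η hξ hη]

end Completion

/-! ### Vector-valued `L_p` spaces -/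

section Lp

variable [Nontrivial L] [CompleteSpace L] {E : Type*} [NormedAddCommGroup E] [NormedSpace ℂ E]
  [PQSpace L E] {X : Type*} [MeasurableSpace X]

/-- The natural map of the amplification of `L_p(X, E)` into `L_p(X, amplification of E)`,
taking `a f` to `t ↦ a (f t)`. -/
def amplLp (L : Type*) [NormedAddCommGroup L] [InnerProductSpace ℂ L] [Nontrivial L]
    [CompleteSpace L] (E : Type*) [NormedAddCommGroup E] [NormedSpace ℂ E] [PQSpace L E]
    (p : ℝ≥0∞) (μ : Measure X) :
    Amp L (Lp E p μ) →ₗ[ℂ] Lp (Amp L E) p μ :=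
  ampLift <| LinearMap.mk₂ ℂ (fun a f => (tmulL E a).compLp f)
    (fun a b f => by
      rw [← ContinuousLinearMap.add_compLp]
      congr 1; ext x; simp)
    (fun c a f => by
      rw [← ContinuousLinearMap.smul_compLp]
      congr 1)
    (fun a f g => ((tmulL E a).compLpₗ p μ).map_add f g)
    (fun c a f => ((tmulL E a).compLpₗ p μ).map_smul c f)

theorem amplLp_tmul (p : ℝ≥0∞) (μ : Measure X) (a : FinRank L) (f : Lp E p μ) :
    amplLp L E p μ (elem a f) = (tmulL E a).compLp f := rfl

theorem amplLp_ampMul (p : ℝ≥0∞) (μ : Measure X) (a b : L →L[ℂ] L)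
    (u : Amp L (Lp E p μ)) :
    amplLp L E p μ (ampMul a b u) = (ampMulL E a b).compLpₗ p μ (amplLp L E p μ u) := by
  induction u using Amp.induction_on with
  | zero => rw [map_zero, map_zero, map_zero]
  | add u v hu hv => simp only [map_add, hu, hv]
  | elem c f =>
    rw [ampMul_elem, amplLp_tmul, amplLp_tmul]
    apply Lp.ext
    filter_upwards [(tmulL E (biMul a b c)).coeFn_compLp f, (tmulL E c).coeFn_compLp f,
      (ampMulL E a b).coeFn_compLp ((tmulL E c).compLp f)] with t h1 h2 h3
    rw [h1, ContinuousLinearMap.compLpₗ_apply, h3, h2]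
    simp

/-- The standard proto-quantization of `L_p(X, E)`: the norm of an element of the amplification
is the norm of the corresponding function with values in the amplification of `E`. -/
instance (p : ℝ≥0∞) [Fact (1 ≤ p)] (μ : Measure X) : PQSpace L (Lp E p μ) where
  pq := (normSeminorm ℂ (Lp (Amp L E) p μ)).comp (amplLp L E p μ)
  pq_ampMul_le a b u := by
    simp only [Seminorm.comp_apply, coe_normSeminorm, amplLp_ampMul]
    refine ((ampMulL E a b).norm_compLp_le _).trans ?_
    rw [mul_right_comm]
    gcongr
    exact norm_ampMulL_le a b
  pq_rankOne ξ η hξ hη f := by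
    simp only [Seminorm.comp_apply, coe_normSeminorm, amplLp_tmul]
    rw [Lp.norm_def, Lp.norm_def]
    congr 1
    refine eLpNorm_congr_norm_ae ?_
    filter_upwards [(tmulL E (rankOne ξ η)).coeFn_compLp f] with t ht
    rw [ht, tmulL_apply, norm_eq_pq, PQSpace.pq_rankOne ξ η hξ hη]

end Lp

/-! ### The projective tensor product -/

section Pop

/-- The vector `ξ ⋄ η`, for a unitary isomorphism `ι` of the Hilbert tensor square of `L`
onto `L`. -/
def dia (ι : Completion (L ⊗[ℂ] L) ≃ₗᵢ[ℂ] L) (ξ η : L) : L := ι ((ξ ⊗ₜ[ℂ] η : L ⊗[ℂ] L))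

/-- The operator `a ⋄ b = ι (a ⊗ b) ι⁻¹`. -/
def diaOp (ι : Completion (L ⊗[ℂ] L) ≃ₗᵢ[ℂ] L) (a b : L →L[ℂ] L) : L →L[ℂ] L :=
  (ι.toContinuousLinearEquiv : Completion (L ⊗[ℂ] L) →L[ℂ] L) ∘L
    (TensorProduct.mapL a b).completion ∘L
      (ι.symm.toContinuousLinearEquiv : L →L[ℂ] Completion (L ⊗[ℂ] L))

variable (ι : Completion (L ⊗[ℂ] L) ≃ₗᵢ[ℂ] L)

@[simp] theorem diaOp_dia (a b : L →L[ℂ] L) (ξ η : L) :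
    diaOp ι a b (dia ι ξ η) = dia ι (a ξ) (b η) := by
  change ι ((TensorProduct.mapL a b).completion (ι.symm (ι _))) = _
  rw [ι.symm_apply_apply, ContinuousLinearMap.completion_apply_coe, TensorProduct.mapL_tmul]
  rfl

theorem dia_ext {a b : L →L[ℂ] L} (h : ∀ ξ η, a (dia ι ξ η) = b (dia ι ξ η)) : a = b := by
  ext x
  obtain ⟨z, rfl⟩ := ι.surjective x
  induction z using Completion.induction_on with
  | hp => exact isClosed_eq (a.continuous.comp ι.continuous) (b.continuous.comp ι.continuous)
  | ih w =>
    induction w using TensorProduct.induction_on with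
    | zero => rw [Completion.coe_zero, map_zero, map_zero, map_zero]
    | add x y hx hy => rw [Completion.coe_add, map_add, map_add, map_add, hx, hy]
    | tmul ξ η => exact h ξ η

theorem dia_add_left (ξ ξ' η : L) : dia ι (ξ + ξ') η = dia ι ξ η + dia ι ξ' η := by
  simp only [dia, TensorProduct.add_tmul, Completion.coe_add, map_add]

theorem dia_add_right (ξ η η' : L) : dia ι ξ (η + η') = dia ι ξ η + dia ι ξ η' := by
  simp only [dia, TensorProduct.tmul_add, Completion.coe_add, map_add]

theorem dia_smul_left (c : ℂ) (ξ η : L) : dia ι (c • ξ) η = c • dia ι ξ η := by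
  simp only [dia, ← TensorProduct.smul_tmul', Completion.coe_smul, map_smul]

theorem dia_smul_right (c : ℂ) (ξ η : L) : dia ι ξ (c • η) = c • dia ι ξ η := by
  simp only [dia, TensorProduct.tmul_smul, Completion.coe_smul, map_smul]

theorem inner_dia (ξ η ξ' η' : L) :
    inner ℂ (dia ι ξ η) (dia ι ξ' η') = inner ℂ ξ ξ' * inner ℂ η η' := by
  simp [dia]

theorem norm_dia (ξ η : L) : ‖dia ι ξ η‖ = ‖ξ‖ * ‖η‖ := by
  simp [dia]

theorem diaOp_rankOne (ξ η ξ' η' : L) :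
    diaOp ι (InnerProductSpace.rankOne ℂ ξ η) (InnerProductSpace.rankOne ℂ ξ' η') =
      InnerProductSpace.rankOne ℂ (dia ι ξ ξ') (dia ι η η') := by
  refine dia_ext ι fun x y => ?_
  simp [inner_dia, dia_smul_left, dia_smul_right, smul_smul, mul_comm]

theorem diaOp_add_left (a a' b : L →L[ℂ] L) :
    diaOp ι (a + a') b = diaOp ι a b + diaOp ι a' b :=
  dia_ext ι fun ξ η => by simp [dia_add_left]

theorem diaOp_add_right (a b b' : L →L[ℂ] L) :
    diaOp ι a (b + b') = diaOp ι a b + diaOp ι a b' :=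
  dia_ext ι fun ξ η => by simp [dia_add_right]

theorem diaOp_smul_left (c : ℂ) (a b : L →L[ℂ] L) : diaOp ι (c • a) b = c • diaOp ι a b :=
  dia_ext ι fun ξ η => by simp [dia_smul_left]

theorem diaOp_smul_right (c : ℂ) (a b : L →L[ℂ] L) : diaOp ι a (c • b) = c • diaOp ι a b :=
  dia_ext ι fun ξ η => by simp [dia_smul_right]

/-- The linear space `E ⊗ F`, to be endowed with the projective proto-quantum semi-norm. -/
def Pop {L : Type*} [NormedAddCommGroup L] [InnerProductSpace ℂ L]
    (_ι : Completion (L ⊗[ℂ] L) ≃ₗᵢ[ℂ] L) (E F : Type*) [AddCommGroup E] [Module ℂ E]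
    [AddCommGroup F] [Module ℂ F] : Type _ := E ⊗[ℂ] F

section PopAlgebra

variable {E F : Type*} [AddCommGroup E] [Module ℂ E] [AddCommGroup F] [Module ℂ F]

instance : AddCommGroup (Pop ι E F) := inferInstanceAs (AddCommGroup (E ⊗[ℂ] F))
instance : Module ℂ (Pop ι E F) := inferInstanceAs (Module ℂ (E ⊗[ℂ] F))

/-- The elementary tensor `x ⊗ y`. -/
def Pop.tmul : E →ₗ[ℂ] F →ₗ[ℂ] Pop ι E F := TensorProduct.mk ℂ E F

theorem Pop.induction_on {ι : Completion (L ⊗[ℂ] L) ≃ₗᵢ[ℂ] L} {P : Pop ι E F → Prop}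
    (w : Pop ι E F) (zero : P 0) (tmul : ∀ x y, P (Pop.tmul ι x y))
    (add : ∀ w w', P w → P w' → P (w + w')) : P w :=
  TensorProduct.induction_on w zero tmul add

end PopAlgebra

variable [CompleteSpace L]

theorem diaOp_mem_finRank (a b : FinRank L) : diaOp ι a.toCLM b.toCLM ∈ finRank L := by
  let T : (L →L[ℂ] L) →ₗ[ℂ] (L →L[ℂ] L) →ₗ[ℂ] (L →L[ℂ] L) :=
    LinearMap.mk₂ ℂ (diaOp ι) (diaOp_add_left ι) (diaOp_smul_left ι) (diaOp_add_right ι)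
      (diaOp_smul_right ι)
  change T a.toCLM b.toCLM ∈ _
  obtain ⟨n, ξ, η, rfl⟩ := finRank_eq_sum a
  obtain ⟨m, ξ', η', rfl⟩ := finRank_eq_sum b
  simp only [map_sum, LinearMap.sum_apply]
  refine Submodule.sum_mem _ fun i _ => Submodule.sum_mem _ fun j _ => ?_
  change diaOp ι _ _ ∈ _
  rw [toCLM_rankOne, toCLM_rankOne, diaOp_rankOne]
  exact (rankOne _ _).2

/-- The operation `a ⋄ b` on finite rank operators. -/
def diaFin : FinRank L →ₗ[ℂ] FinRank L →ₗ[ℂ] FinRank L :=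
  LinearMap.mk₂ ℂ (fun a b => ⟨diaOp ι a.toCLM b.toCLM, diaOp_mem_finRank ι a b⟩)
    (fun a a' b => Subtype.ext <| (congrArg (diaOp ι · b.toCLM) (map_add _ a a')).trans
      (diaOp_add_left ι _ _ _))
    (fun c a b => Subtype.ext <| (congrArg (diaOp ι · b.toCLM) (map_smul _ c a)).trans
      (diaOp_smul_left ι _ _ _))
    (fun a b b' => Subtype.ext <| (congrArg (diaOp ι a.toCLM) (map_add _ b b')).trans
      (diaOp_add_right ι _ _ _))
    (fun c a b => Subtype.ext <| (congrArg (diaOp ι a.toCLM) (map_smul _ c b)).trans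
      (diaOp_smul_right ι _ _ _))

@[simp] theorem toCLM_diaFin (a b : FinRank L) :
    (diaFin ι a b).toCLM = diaOp ι a.toCLM b.toCLM := rfl

section Algebra

variable {E F : Type*} [AddCommGroup E] [Module ℂ E] [AddCommGroup F] [Module ℂ F]

/-- The bilinear operation `u ⋄ v`, with `a x ⋄ b y = (a ⋄ b) (x ⊗ y)`. -/
def diaAmp : Amp L E →ₗ[ℂ] Amp L F →ₗ[ℂ] Amp L (Pop ι E F) :=
  TensorProduct.curry (TensorProduct.map (TensorProduct.lift (diaFin ι)) LinearMap.id ∘ₗ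
    (TensorProduct.tensorTensorTensorComm ℂ (FinRank L) E (FinRank L) F).toLinearMap)

@[simp] theorem diaAmp_elem (a b : FinRank L) (x : E) (y : F) :
    diaAmp ι (elem a x) (elem b y) = elem (diaFin ι a b) (Pop.tmul ι x y) := rfl

end Algebra

section Norm

variable {E F : Type*} [SeminormedAddCommGroup E] [NormedSpace ℂ E] [PQSpace L E]
  [SeminormedAddCommGroup F] [NormedSpace ℂ F] [PQSpace L F]

/-- The values `∑ ‖a_k‖ ‖u_k‖ ‖v_k‖ ‖b_k‖` over all representations of `U` as a sum
`∑ a_k · (u_k ⋄ v_k) · b_k`. -/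
def popValues (U : Amp L (Pop ι E F)) : Set ℝ :=
  {r | ∃ (n : ℕ) (a b : Fin n → L →L[ℂ] L) (u : Fin n → Amp L E) (v : Fin n → Amp L F),
    U = ∑ k, ampMul (a k) (b k) (diaAmp ι (u k) (v k)) ∧
    r = ∑ k, ‖a k‖ * PQSpace.pq (u k) * PQSpace.pq (v k) * ‖b k‖}

theorem popValues_nonneg {U : Amp L (Pop ι E F)} {r : ℝ} (hr : r ∈ popValues ι U) : 0 ≤ r := by
  obtain ⟨n, a, b, u, v, -, rfl⟩ := hr
  exact Finset.sum_nonneg fun k _ => by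
    have := apply_nonneg (PQSpace.pq (L := L) (E := E)) (u k)
    have := apply_nonneg (PQSpace.pq (L := L) (E := F)) (v k)
    positivity

theorem popValues_bddBelow (U : Amp L (Pop ι E F)) : BddBelow (popValues ι U) :=
  ⟨0, fun _ hr => popValues_nonneg ι hr⟩

theorem popValues_add {U V : Amp L (Pop ι E F)} {r s : ℝ} (hr : r ∈ popValues ι U)
    (hs : s ∈ popValues ι V) : r + s ∈ popValues ι (U + V) := by
  obtain ⟨n, a, b, u, v, rfl, rfl⟩ := hr
  obtain ⟨m, a', b', u', v', rfl, rfl⟩ := hs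
  refine ⟨n + m, Fin.append a a', Fin.append b b', Fin.append u u', Fin.append v v', ?_, ?_⟩ <;>
  simp [Fin.sum_univ_add]

theorem popValues_ampMul {U : Amp L (Pop ι E F)} {r : ℝ} (hr : r ∈ popValues ι U)
    (a b : L →L[ℂ] L) : ∃ s ∈ popValues ι (ampMul a b U), s ≤ ‖a‖ * r * ‖b‖ := by
  obtain ⟨n, a', b', u, v, rfl, rfl⟩ := hr
  refine ⟨_, ⟨n, fun k => a ∘L a' k, fun k => b' k ∘L b, u, v, ?_, rfl⟩, ?_⟩
  · rw [map_sum]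
    refine Finset.sum_congr rfl fun k _ => ?_
    exact ampMul_ampMul _ _ _ _ _
  · rw [Finset.mul_sum, Finset.sum_mul]
    refine Finset.sum_le_sum fun k _ => ?_
    have h1 := apply_nonneg (PQSpace.pq (L := L) (E := E)) (u k)
    have h2 := apply_nonneg (PQSpace.pq (L := L) (E := F)) (v k)
    calc ‖a ∘L a' k‖ * PQSpace.pq (u k) * PQSpace.pq (v k) * ‖b' k ∘L b‖
        ≤ (‖a‖ * ‖a' k‖) * PQSpace.pq (u k) * PQSpace.pq (v k) * (‖b' k‖ * ‖b‖) := by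
          gcongr
          · exact ContinuousLinearMap.opNorm_comp_le _ _
          · exact ContinuousLinearMap.opNorm_comp_le _ _
      _ = _ := by ring

theorem popValues_smul {U : Amp L (Pop ι E F)} {r : ℝ} (hr : r ∈ popValues ι U)
    (c : ℂ) : ‖c‖ * r ∈ popValues ι (c • U) := by
  obtain ⟨n, a, b, u, v, rfl, rfl⟩ := hr
  refine ⟨n, a, b, fun k => c • u k, v, ?_, ?_⟩
  · simp [Finset.smul_sum]
  · rw [Finset.mul_sum]
    refine Finset.sum_congr rfl fun k _ => ?_
    rw [map_smul_eq_mul]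
    ring

variable [Nontrivial L]

theorem popValues_nonempty (U : Amp L (Pop ι E F)) : (popValues ι U).Nonempty := by
  obtain ⟨e, he⟩ := exists_unit L
  induction U using Amp.induction_on with
  | zero => exact ⟨0, 0, Fin.elim0, Fin.elim0, Fin.elim0, Fin.elim0, by simp, by simp⟩
  | add U V hU hV =>
    obtain ⟨r, hr⟩ := hU
    obtain ⟨s, hs⟩ := hV
    exact ⟨_, popValues_add ι hr hs⟩
  | elem c w =>
    induction w using Pop.induction_on with
    | zero =>
      exact ⟨0, 0, Fin.elim0, Fin.elim0, Fin.elim0, Fin.elim0, by simp, by simp⟩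
    | add w w' h h' =>
      obtain ⟨r, hr⟩ := h
      obtain ⟨s, hs⟩ := h'
      have := popValues_add ι hr hs
      rw [← map_add] at this
      exact ⟨_, this⟩
    | tmul x y =>
      obtain ⟨n, ξ, η, rfl⟩ := finRank_eq_sum c
      refine ⟨_, n, fun i => (rankOne (ξ i) (dia ι e e)).toCLM,
        fun i => (rankOne (dia ι e e) (η i)).toCLM, fun _ => elem (rankOne e e) x,
        fun _ => elem (rankOne e e) y, ?_, rfl⟩
      rw [map_sum, LinearMap.sum_apply]
      refine Finset.sum_congr rfl fun i _ => ?_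
      rw [ampMul_rankOne, diaAmp_elem, coeff_elem, toCLM_diaFin, toCLM_rankOne, diaOp_rankOne]
      simp [he, norm_dia]

/-- The semi-norm `‖U‖_pop`, the infimum of `∑ ‖a_k‖ ‖u_k‖ ‖v_k‖ ‖b_k‖` over all representations
`U = ∑ a_k · (u_k ⋄ v_k) · b_k`. -/
def popSeminorm (E F : Type*) [SeminormedAddCommGroup E] [NormedSpace ℂ E] [PQSpace L E]
    [SeminormedAddCommGroup F] [NormedSpace ℂ F] [PQSpace L F] :
    Seminorm ℂ (Amp L (Pop ι E F)) :=
  Seminorm.ofSMulLE (fun U => sInf (popValues ι U))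
    (le_antisymm (csInf_le (popValues_bddBelow ι _)
        ⟨0, Fin.elim0, Fin.elim0, Fin.elim0, Fin.elim0, by simp, by simp⟩)
      (Real.sInf_nonneg fun _ hr => popValues_nonneg ι hr))
    (fun U V => le_of_forall_pos_lt_add fun ε hε => by
      obtain ⟨r, hr, hr'⟩ := Real.lt_sInf_add_pos (popValues_nonempty ι U) (half_pos hε)
      obtain ⟨s, hs, hs'⟩ := Real.lt_sInf_add_pos (popValues_nonempty ι V) (half_pos hε)
      have := csInf_le (popValues_bddBelow ι _) (popValues_add ι hr hs)
      linarith)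
    (fun c U => by
      rw [← smul_eq_mul, ← Real.sInf_smul_of_nonneg (norm_nonneg c)]
      refine le_csInf (popValues_nonempty ι U).smul_set ?_
      rintro _ ⟨r, hr, rfl⟩
      exact csInf_le (popValues_bddBelow ι _) (popValues_smul ι hr c))

theorem popSeminorm_apply (U : Amp L (Pop ι E F)) :
    popSeminorm ι E F U = sInf (popValues ι U) := rfl

theorem popSeminorm_ampMul_le (a b : L →L[ℂ] L) (U : Amp L (Pop ι E F)) :
    popSeminorm ι E F (ampMul a b U) ≤ ‖a‖ * popSeminorm ι E F U * ‖b‖ := by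
  rw [mul_right_comm, popSeminorm_apply, popSeminorm_apply, ← smul_eq_mul,
    ← Real.sInf_smul_of_nonneg (by positivity)]
  refine le_csInf (popValues_nonempty ι U).smul_set ?_
  rintro _ ⟨r, hr, rfl⟩
  obtain ⟨s, hs, hs'⟩ := popValues_ampMul ι hr a b
  refine (csInf_le (popValues_bddBelow ι _) hs).trans (hs'.trans_eq ?_)
  simp only [smul_eq_mul]
  ring

/-- The underlying semi-norm of `E ⊗_pop F`, `w ↦ ‖Q w‖_pop` with `Q` of rank one and norm one
(the choice of `Q` is immaterial, see the instance of `PQSpace` below). -/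
def popUnderlying (E F : Type*) [SeminormedAddCommGroup E] [NormedSpace ℂ E] [PQSpace L E]
    [SeminormedAddCommGroup F] [NormedSpace ℂ F] [PQSpace L F] : Seminorm ℂ (Pop ι E F) :=
  (popSeminorm ι E F).comp
    (elem (rankOne (exists_unit L).choose (exists_unit L).choose))

instance : SeminormedAddCommGroup (Pop ι E F) :=
  (popUnderlying ι E F).toAddGroupSeminorm.toSeminormedAddCommGroup

instance : NormedSpace ℂ (Pop ι E F) where
  norm_smul_le c w := (map_smul_eq_mul (popUnderlying ι E F) c w).le

/-- The (non-completed) projective tensor product `E ⊗_pop F`; the completed one is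
`Completion (Pop ι E F)`. -/
instance : PQSpace L (Pop ι E F) where
  pq := popSeminorm ι E F
  pq_ampMul_le := popSeminorm_ampMul_le ι
  pq_rankOne ξ η hξ hη w := by
    have he := (exists_unit L).choose_spec
    set e := (exists_unit L).choose
    change _ = popSeminorm ι E F (elem (rankOne e e) w)
    apply le_antisymm
    · have := popSeminorm_ampMul_le ι (rankOne ξ e).toCLM (rankOne e η).toCLM
        (elem (rankOne e e) w)
      rw [ampMul_rankOne] at this
      simpa [he, hξ, hη] using this
    · have := popSeminorm_ampMul_le ι (rankOne e ξ).toCLM (rankOne η e).toCLM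
        (elem (rankOne ξ η) w)
      rw [ampMul_rankOne] at this
      simpa [he, hξ, hη] using this

end Norm

end Pop

/-! ### Complete isometries -/

/-- A linear operator is completely isometric if its amplification is isometric. -/
def IsCompletelyIsometric (L : Type*) [NormedAddCommGroup L] [InnerProductSpace ℂ L]
    {E F : Type*} [SeminormedAddCommGroup E] [NormedSpace ℂ E] [PQSpace L E]
    [SeminormedAddCommGroup F] [NormedSpace ℂ F] [PQSpace L F] (φ : E →ₗ[ℂ] F) : Prop :=
  ∀ u : Amp L E, PQSpace.pq (ampMap L φ u) = PQSpace.pq u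

/-! ### Products of arbitrary measures -/

section Product

variable {X Y : Type*} [MeasurableSpace X] [MeasurableSpace Y]

/-- The outer measure of a set is the infimum of `∑ μ (A_i) ν (B_i)` over all countable coverings
by measurable rectangles `A_i × B_i`. -/
def prodOuter (μ : Measure X) (ν : Measure Y) : OuterMeasure (X × Y) :=
  OuterMeasure.ofFunction
    (fun S => ⨅ (A : Set X) (B : Set Y) (_ : MeasurableSet A) (_ : MeasurableSet B)
      (_ : S ⊆ A ×ˢ B), μ A * ν B)
    (le_antisymm (iInf₂_le_of_le ∅ ∅ (by simp)) bot_le)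

/-- The product of two arbitrary measures on the product σ-algebra: the Carathéodory extension of
`A × B ↦ μ A * ν B`. For σ-finite measures it is `μ.prod ν`. -/
def prodMeasure (μ : Measure X) (ν : Measure Y) : Measure (X × Y) :=
  (prodOuter μ ν).toMeasure (by
    refine sup_le ?_ ?_ <;> rintro _ ⟨S, hS, rfl⟩ <;>
    refine OuterMeasure.ofFunction_caratheodory fun T => ?_ <;>
    refine le_iInf fun A => le_iInf fun B => le_iInf fun hA => le_iInf fun hB =>
      le_iInf fun hT => ?_
    · refine (add_le_add (b := μ (A ∩ S) * ν B) (d := μ (A \ S) * ν B) ?_ ?_).trans_eq ?_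
      · refine iInf₂_le_of_le (A ∩ S) B (iInf₂_le_of_le (hA.inter hS) hB (iInf_le_of_le ?_ le_rfl))
        exact fun p hp => ⟨⟨(hT hp.1).1, hp.2⟩, (hT hp.1).2⟩
      · refine iInf₂_le_of_le (A \ S) B (iInf₂_le_of_le (hA.diff hS) hB (iInf_le_of_le ?_ le_rfl))
        exact fun p hp => ⟨⟨(hT hp.1).1, hp.2⟩, (hT hp.1).2⟩
      · rw [← add_mul, measure_inter_add_sdiff A hS]
    · refine (add_le_add (b := μ A * ν (B ∩ S)) (d := μ A * ν (B \ S)) ?_ ?_).trans_eq ?_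
      · refine iInf₂_le_of_le A (B ∩ S) (iInf₂_le_of_le hA (hB.inter hS) (iInf_le_of_le ?_ le_rfl))
        exact fun p hp => ⟨(hT hp.1).1, ⟨(hT hp.1).2, hp.2⟩⟩
      · refine iInf₂_le_of_le A (B \ S) (iInf₂_le_of_le hA (hB.diff hS) (iInf_le_of_le ?_ le_rfl))
        exact fun p hp => ⟨(hT hp.1).1, ⟨(hT hp.1).2, hp.2⟩⟩
      · rw [← mul_add, measure_inter_add_sdiff B hS])

end Product

end PQ
end

noncomputable section

namespace PQ

/-! ### The product of two arbitrary measures -/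

section ProductMeasure

/-! The map sending `x ⊗ y` to the function `(s, t) ↦ x s ⊗ y t` is shown to be completely isometric
already on the uncompleted tensor product (`isCompletelyIsometric_popLp`). It then extends to the
completion, and its closed range is shown to be everything.

Contractivity is the maximality of the projective norm. Every term `a · (u ⋄ v) · b` of a
representation goes to a function whose value at `(s, t)` has norm at most `‖a‖ ‖u s‖ ‖v t‖ ‖b‖`.
The integral of `‖u s‖ ‖v t‖` splits as `‖u‖ ‖v‖` by Tonelli for products of functions of one
variable (`lintegral_mul_prodMeasure`), which needs no σ-finiteness.

The reverse estimate comes from simple functions (`norm_le_norm_ampMap_popLp_of_simpleFunc`). On a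
partition into cells `A × B`, an element `U` of the amplification is the sum of the images of its
values `W` on the cells under the amplified tensor product of `x ↦ χ_A x` and `y ↦ χ_B y`. Each such
image has norm at most `μ(A) ν(B) ‖W‖`, and these bounds add up to exactly the `L_1` norm of the
function. Density and continuity extend the estimate to all `U`.

For surjectivity, the range contains the functions equal to `x ⊗ y` on rectangles with sides of
finite measure. A set of finite product measure is covered by countably many rectangles of finite
measure, so a Dynkin class argument inside each of them gives all indicators
(`indicatorConstLp_mem_of_rectangles`), and these span a dense subspace. Uniqueness holds because a
complete isometry is continuous and the elementary tensors span a dense subspace. -/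

theorem lintegral_section_indicator_prod {X Y : Type*} [MeasurableSpace Y] {ν : Measure Y}
    {A : Set X} {B : Set Y} (hB : MeasurableSet B) (s : X) :
    ∫⁻ t, (A ×ˢ B).indicator (1 : X × Y → ℝ≥0∞) (s, t) ∂ν = A.indicator (fun _ => ν B) s := by
  by_cases hs : s ∈ A
  · rw [Set.indicator_of_mem hs, ← lintegral_indicator_one hB]
    refine lintegral_congr fun t => ?_
    by_cases ht : t ∈ B <;> simp [hs, ht]
  · simp [hs]

variable {X Y : Type*} [MeasurableSpace X] [MeasurableSpace Y] {μ : Measure X} {ν : Measure Y}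

theorem prodMeasure_apply {S : Set (X × Y)} (hS : MeasurableSet S) :
    prodMeasure μ ν S = prodOuter μ ν S :=
  toMeasure_apply _ _ hS

/-- This replaces σ-finiteness: a set of finite measure lies in countably many rectangles, each of
finite measure. -/
theorem exists_rectangle_cover {S : Set (X × Y)} (hS : MeasurableSet S) {r : ℝ≥0∞}
    (h : prodMeasure μ ν S < r) :
    ∃ (A : ℕ → Set X) (B : ℕ → Set Y), (∀ n, MeasurableSet (A n)) ∧ (∀ n, MeasurableSet (B n)) ∧
      S ⊆ ⋃ n, A n ×ˢ B n ∧ (∀ n, μ (A n) * ν (B n) < ∞) ∧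
      ∑' n, μ (A n) * ν (B n) < r := by
  rw [prodMeasure_apply hS, prodOuter, OuterMeasure.ofFunction_apply] at h
  simp only [iInf_lt_iff] at h
  obtain ⟨t, hst, ht⟩ := h
  -- The cost of each covering set is itself an infimum over rectangles. Choosing a rectangle within
  -- `δ n` of it keeps the total below `r`, since the `δ n` sum to less than the slack.
  obtain ⟨δ, hδ0, hδ⟩ := ENNReal.exists_pos_sum_of_countable' (tsub_pos_of_lt ht).ne' ℕ
  have hfin := fun n => ENNReal.lt_add_right (ENNReal.ne_top_of_tsum_ne_top ht.ne_top n) (hδ0 n).ne'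
  simp only [iInf_lt_iff] at hfin
  choose A B hA hB htAB hlt using hfin
  refine ⟨A, B, hA, hB, hst.trans (Set.iUnion_mono htAB), fun n => (hlt n).trans_le le_top, ?_⟩
  calc ∑' n, μ (A n) * ν (B n) ≤ _ := ENNReal.tsum_le_tsum fun n => (hlt n).le
    _ = _ := ENNReal.tsum_add
    _ < _ := by rw [add_comm]; exact lt_tsub_iff_right.1 hδ

theorem lintegral_lintegral_indicator_prod {A : Set X} {B : Set Y} (hA : MeasurableSet A)
    (hB : MeasurableSet B) :
    ∫⁻ s, ∫⁻ t, (A ×ˢ B).indicator 1 (s, t) ∂ν ∂μ = μ A * ν B := by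
  simp_rw [lintegral_section_indicator_prod hB]
  rw [lintegral_indicator_const hA, mul_comm]

/-- A rectangle covers itself, which bounds its measure above. Conversely, for any countable cover,
the indicator of the rectangle is at most the sum of the covering indicators, and iterated
integration of this inequality gives the lower bound. The inner integrals of rectangles are
explicit, so they are measurable for arbitrary `ν`. -/
theorem prodMeasure_prod {A : Set X} {B : Set Y} (hA : MeasurableSet A) (hB : MeasurableSet B) :
    prodMeasure μ ν (A ×ˢ B) = μ A * ν B := by
  apply le_antisymm
  · rw [prodMeasure_apply (hA.prod hB)]
    refine (OuterMeasure.ofFunction_le _).trans ?_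
    exact iInf₂_le_of_le A B (iInf₂_le_of_le hA hB (iInf_le_of_le subset_rfl le_rfl))
  · refine le_of_forall_gt fun r hr => ?_
    obtain ⟨A', B', hA', hB', hsub, -, hlt⟩ := exists_rectangle_cover (hA.prod hB) hr
    refine lt_of_le_of_lt ?_ hlt
    simp_rw [← lintegral_lintegral_indicator_prod hA hB,
      ← fun n => lintegral_lintegral_indicator_prod (μ := μ) (ν := ν) (hA' n) (hB' n)]
    have hm : ∀ n, Measurable (((A' n) ×ˢ (B' n)).indicator (1 : X × Y → ℝ≥0∞)) :=
      fun n => measurable_one.indicator ((hA' n).prod (hB' n))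
    have hm2 : ∀ n, Measurable fun s =>
        ∫⁻ t, ((A' n) ×ˢ (B' n)).indicator (1 : X × Y → ℝ≥0∞) (s, t) ∂ν := by
      intro n
      simp_rw [lintegral_section_indicator_prod (hB' n)]
      exact measurable_const.indicator (hA' n)
    rw [← lintegral_tsum fun n => (hm2 n).aemeasurable]
    refine lintegral_mono fun s => ?_
    have hms : ∀ n, Measurable fun t => ((A' n) ×ˢ (B' n)).indicator (1 : X × Y → ℝ≥0∞) (s, t) :=
      fun n => (hm n).comp measurable_prodMk_left
    rw [← lintegral_tsum fun n => (hms n).aemeasurable]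
    refine lintegral_mono fun t => ?_
    by_cases hp : (s, t) ∈ A ×ˢ B
    · obtain ⟨n, hn⟩ := Set.mem_iUnion.1 (hsub hp)
      refine le_trans ?_ (ENNReal.le_tsum n)
      simp only [Set.indicator_of_mem hp, Set.indicator_of_mem hn, le_refl]
    · simp only [Set.indicator_of_notMem hp, zero_le]

theorem quasiMeasurePreserving_fst_prodMeasure :
    Measure.QuasiMeasurePreserving Prod.fst (prodMeasure μ ν) μ := by
  refine ⟨measurable_fst, Measure.AbsolutelyContinuous.mk fun N hN h => ?_⟩
  -- The convention `0 * ∞ = 0` covers the case of infinite `ν`.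
  rw [Measure.map_apply measurable_fst hN, ← Set.prod_univ, prodMeasure_prod hN .univ, h, zero_mul]

theorem quasiMeasurePreserving_snd_prodMeasure :
    Measure.QuasiMeasurePreserving Prod.snd (prodMeasure μ ν) ν := by
  refine ⟨measurable_snd, Measure.AbsolutelyContinuous.mk fun N hN h => ?_⟩
  rw [Measure.map_apply measurable_snd hN, ← Set.univ_prod, prodMeasure_prod .univ hN, h, mul_zero]

theorem ae_prodMeasure_fst {P : X → Prop} (h : ∀ᵐ s ∂μ, P s) :
    ∀ᵐ p ∂prodMeasure μ ν, P p.1 :=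
  quasiMeasurePreserving_fst_prodMeasure.ae h

theorem ae_prodMeasure_snd {P : Y → Prop} (h : ∀ᵐ t ∂ν, P t) :
    ∀ᵐ p ∂prodMeasure μ ν, P p.2 :=
  quasiMeasurePreserving_snd_prodMeasure.ae h

/-- Tonelli's theorem for products of functions of one variable and arbitrary measures. -/
theorem lintegral_mul_prodMeasure {f : X → ℝ≥0∞} (hf : Measurable f) {g : Y → ℝ≥0∞}
    (hg : Measurable g) :
    ∫⁻ p, f p.1 * g p.2 ∂prodMeasure μ ν = (∫⁻ s, f s ∂μ) * ∫⁻ t, g t ∂ν := by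
  -- Both sides are additive and monotone continuous in each factor, so two nested inductions reduce
  -- the claim to a pair of indicators, that is, to the measure of a rectangle.
  refine Measurable.ennreal_induction (motive := fun f => Measurable f → ∫⁻ p, f p.1 * g p.2
    ∂prodMeasure μ ν = (∫⁻ s, f s ∂μ) * ∫⁻ t, g t ∂ν) ?_ ?_ ?_ hf hf
  · intro c A hA _
    refine Measurable.ennreal_induction (motive := fun g =>
      ∫⁻ p, A.indicator (fun _ => c) p.1 * g p.2 ∂prodMeasure μ ν =
        (∫⁻ s, A.indicator (fun _ => c) s ∂μ) * ∫⁻ t, g t ∂ν) ?_ ?_ ?_ hg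
    · intro d B hB
      have : (fun p : X × Y => A.indicator (fun _ => c) p.1 * B.indicator (fun _ => d) p.2) =
          (A ×ˢ B).indicator fun _ => c * d := by
        ext p
        by_cases h1 : p.1 ∈ A <;> by_cases h2 : p.2 ∈ B <;> simp [Set.indicator, h1, h2]
      rw [this, lintegral_indicator_const (hA.prod hB), prodMeasure_prod hA hB,
        lintegral_indicator_const hA, lintegral_indicator_const hB]
      ring
    · intro g g' _ hg hg' h h'
      simp only [Pi.add_apply, mul_add]
      rw [lintegral_add_left, h, h', lintegral_add_left hg, mul_add]
      exact ((measurable_const.indicator hA).comp measurable_fst).mul (hg.comp measurable_snd)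
    · intro g hg hmono h
      simp only [ENNReal.mul_iSup]
      rw [lintegral_iSup, lintegral_iSup hg hmono, ENNReal.mul_iSup]
      · simp only [h]
      · exact fun n =>
          ((measurable_const.indicator hA).comp measurable_fst).mul ((hg n).comp measurable_snd)
      · exact fun m n hmn p => mul_le_mul_right (hmono hmn p.2) _
  · intro f f' _ hf hf' h h' _
    simp only [Pi.add_apply, add_mul]
    rw [lintegral_add_left, h hf, h' hf', lintegral_add_left hf, add_mul]
    exact (hf.comp measurable_fst).mul (hg.comp measurable_snd)
  · intro f hf hmono h _
    simp only [ENNReal.iSup_mul]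
    rw [lintegral_iSup, lintegral_iSup hf hmono, ENNReal.iSup_mul]
    · simp only [h _ (hf _)]
    · exact fun n => ((hf n).comp measurable_fst).mul (hg.comp measurable_snd)
    · exact fun m n hmn p => mul_le_mul_left (hmono hmn p.1) _

end ProductMeasure

/-! ### From rectangles to all sets of finite measure -/

section IndicatorSpan

open scoped symmDiff

variable {Z G : Type*} [MeasurableSpace Z] {m : Measure Z} [NormedAddCommGroup G] [NormedSpace ℂ G]
  {M : Submodule ℂ (Lp G 1 m)} {c : G}

/-- Since the union has finite measure, the finite partial unions converge to it in measure. Their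
indicators therefore converge in `L_1`, and `M` is closed. -/
theorem indicatorConstLp_iUnion_mem (hM : IsClosed (M : Set (Lp G 1 m))) {f : ℕ → Set Z}
    (hd : Pairwise (Function.onFun Disjoint f)) (hf : ∀ i, MeasurableSet (f i))
    (h : ∀ i (hi : m (f i) ≠ ∞), indicatorConstLp 1 (hf i) hi c ∈ M)
    (hU : m (⋃ i, f i) ≠ ∞) : indicatorConstLp 1 (MeasurableSet.iUnion hf) hU c ∈ M := by
  have hfin : ∀ i, m (f i) ≠ ∞ := fun i => measure_ne_top_of_subset (Set.subset_iUnion f i) hU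
  have hacc : ∀ n, MeasurableSet (Set.accumulate f n) := fun n =>
    MeasurableSet.biUnion (Set.to_countable _) fun i _ => hf i
  have haccU : ∀ n, Set.accumulate f n ⊆ ⋃ i, f i := fun n =>
    Set.iUnion₂_subset fun i _ => Set.subset_iUnion f i
  have haccfin : ∀ n, m (Set.accumulate f n) ≠ ∞ := fun n =>
    measure_ne_top_of_subset (haccU n) hU
  refine hM.mem_of_tendsto (b := Filter.atTop)
    (f := fun n => indicatorConstLp 1 (hacc n) (haccfin n) c)
    (tendsto_indicatorConstLp_set ENNReal.one_ne_top ?_) (Filter.Eventually.of_forall fun n => ?_)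
  · have h1 : ∀ n, m (Set.accumulate f n ∆ ⋃ i, f i) = m (⋃ i, f i) - m (Set.accumulate f n) := by
      intro n
      rw [Set.symmDiff_def, Set.sdiff_eq_empty.2 (haccU n), Set.empty_union,
        measure_sdiff (haccU n) (hacc n).nullMeasurableSet (haccfin n)]
    simp only [h1]
    have := ENNReal.Tendsto.sub (tendsto_const_nhds (x := m (⋃ i, f i)) (f := Filter.atTop))
      (tendsto_measure_iUnion_accumulate (μ := m) (f := f)) (Or.inl hU)
    rwa [tsub_self] at this
  · change indicatorConstLp 1 (hacc n) (haccfin n) c ∈ M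
    induction n with
    | zero =>
      have : Set.accumulate f 0 = f 0 := by simp
      convert h 0 (hfin 0)
    | succ n ih =>
      have hs : Set.accumulate f (n + 1) = Set.accumulate f n ∪ f (n + 1) := by
        rw [Set.accumulate_succ]
      have hdis : Disjoint (Set.accumulate f n) (f (n + 1)) :=
        Set.disjoint_accumulate hd n.lt_succ_self
      have := M.add_mem ih (h (n + 1) (hfin (n + 1)))
      rw [← indicatorConstLp_disjoint_union _ _ _ _ hdis] at this
      convert this

theorem indicatorConstLp_mem_of_null {S : Set Z} (hS : MeasurableSet S) (h0 : m S = 0)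
    (h : m S ≠ ∞) : indicatorConstLp 1 hS h c ∈ M := by
  have : indicatorConstLp 1 hS h c = 0 := by
    rw [← norm_eq_zero, norm_indicatorConstLp one_ne_zero ENNReal.one_ne_top]
    simp [measureReal_def, h0]
  rw [this]
  exact M.zero_mem

theorem indicatorConstLp_diff_mem {S T : Set Z} (hS : MeasurableSet S) (hT : MeasurableSet T)
    (hST : T ⊆ S) (hfS : m S ≠ ∞) (hfT : m T ≠ ∞) (h1 : indicatorConstLp 1 hS hfS c ∈ M)
    (h2 : indicatorConstLp 1 hT hfT c ∈ M) (hf : m (S \ T) ≠ ∞) :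
    indicatorConstLp 1 (hS.diff hT) hf c ∈ M := by
  have h := indicatorConstLp_disjoint_union (p := 1) (hS.diff hT) hT hf hfT
    Set.disjoint_sdiff_left c
  have h3 := M.sub_mem h1 h2
  convert h3
  rw [eq_sub_iff_add_eq, ← h]
  congr 1
  exact Set.sdiff_union_of_subset hST

variable {X Y : Type*} [MeasurableSpace X] [MeasurableSpace Y] {μ : Measure X} {ν : Measure Y}

/-- A closed subspace of `L_1(X × Y, G)` that contains the functions `c` on all rectangles with
sides of finite measure contains the function `c` on each set of finite measure. -/
theorem indicatorConstLp_mem_of_rectangles {M : Submodule ℂ (Lp G 1 (prodMeasure μ ν))}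
    (hM : IsClosed (M : Set (Lp G 1 (prodMeasure μ ν))))
    (h : ∀ (A : Set X) (B : Set Y) (hA : MeasurableSet A) (hB : MeasurableSet B), μ A ≠ ∞ →
      ν B ≠ ∞ → ∀ hAB : prodMeasure μ ν (A ×ˢ B) ≠ ∞, indicatorConstLp 1 (hA.prod hB) hAB c ∈ M)
    {S : Set (X × Y)} (hS : MeasurableSet S) (hfS : prodMeasure μ ν S ≠ ∞) :
    indicatorConstLp 1 hS hfS c ∈ M := by
  -- Localizing to a rectangle of finite measure keeps relative complements of finite measure, which
  -- makes the π-λ theorem applicable.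
  have key : ∀ (A : Set X) (B : Set Y) (hA : MeasurableSet A) (hB : MeasurableSet B),
      μ A * ν B < ∞ → ∀ (T : Set (X × Y)) (hT : MeasurableSet T)
      (hf : prodMeasure μ ν (A ×ˢ B ∩ T) ≠ ∞),
      indicatorConstLp 1 ((hA.prod hB).inter hT) hf c ∈ M := by
    intro A B hA hB hAB
    have hABf : prodMeasure μ ν (A ×ˢ B) ≠ ∞ := by rw [prodMeasure_prod hA hB]; exact hAB.ne
    -- A rectangle of measure zero may have a side of infinite measure, to which `h` does not apply.
    -- In the remaining case both sides have finite measure.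
    by_cases h0 : prodMeasure μ ν (A ×ˢ B) = 0
    · intro T hT hf
      exact indicatorConstLp_mem_of_null _
        (le_antisymm ((measure_mono Set.inter_subset_left).trans_eq h0) zero_le) _
    have h0' := h0
    rw [prodMeasure_prod hA hB, mul_eq_zero, not_or] at h0'
    have hA' : μ A ≠ ∞ := fun hh => by simp [hh, h0'.2, ENNReal.top_mul] at hAB
    have hB' : ν B ≠ ∞ := fun hh => by simp [hh, h0'.1, ENNReal.mul_top] at hAB
    intro T hT
    induction T, hT using MeasurableSpace.induction_on_inter
      (generateFrom_prod (α := X) (β := Y)).symm isPiSystem_prod with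
    | empty =>
      intro hf
      exact indicatorConstLp_mem_of_null _ (by simp) _
    | basic T hT =>
      obtain ⟨A', hA2, B', hB2, rfl⟩ := hT
      intro hf
      have e : A ×ˢ B ∩ A' ×ˢ B' = (A ∩ A') ×ˢ (B ∩ B') := Set.prod_inter_prod
      have := h (A ∩ A') (B ∩ B') (hA.inter hA2) (hB.inter hB2)
        (measure_ne_top_of_subset Set.inter_subset_left hA')
        (measure_ne_top_of_subset Set.inter_subset_left hB') (by rwa [← e])
      convert this
    | compl T hT ih =>
      intro hf
      have hfT : prodMeasure μ ν (A ×ˢ B ∩ T) ≠ ∞ :=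
        measure_ne_top_of_subset Set.inter_subset_left hABf
      have e : A ×ˢ B ∩ Tᶜ = A ×ˢ B \ (A ×ˢ B ∩ T) := by
        rw [Set.sdiff_self_inter, Set.sdiff_eq]
      have := indicatorConstLp_diff_mem (hA.prod hB) ((hA.prod hB).inter hT)
        Set.inter_subset_left hABf hfT (h A B hA hB hA' hB' hABf) (ih hfT) (by rwa [← e])
      convert this
    | iUnion f hd hf ih =>
      intro hff
      have e : A ×ˢ B ∩ ⋃ i, f i = ⋃ i, A ×ˢ B ∩ f i := Set.inter_iUnion _ _
      have := indicatorConstLp_iUnion_mem hM (f := fun i => A ×ˢ B ∩ f i)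
        (fun i j hij => (hd hij).mono Set.inter_subset_right Set.inter_subset_right)
        (fun i => (hA.prod hB).inter (hf i)) ih (by rwa [← e])
      convert this
  obtain ⟨A, B, hA, hB, hsub, hlt, -⟩ := exists_rectangle_cover hS (lt_top_iff_ne_top.2 hfS)
  have hR : ∀ i, MeasurableSet (A i ×ˢ B i) := fun i => (hA i).prod (hB i)
  have hD : ∀ i, MeasurableSet (disjointed (fun i => A i ×ˢ B i) i) := fun i =>
    MeasurableSet.disjointed hR i
  -- Disjointing the cover cuts `S` into disjoint pieces. The outer intersection with the rectangle
  -- is redundant and gives each piece the shape treated in `key`.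
  have e : S = ⋃ i, A i ×ˢ B i ∩ (disjointed (fun i => A i ×ˢ B i) i ∩ S) := by
    have : ∀ i, A i ×ˢ B i ∩ (disjointed (fun i => A i ×ˢ B i) i ∩ S) =
        disjointed (fun i => A i ×ˢ B i) i ∩ S := fun i =>
      Set.inter_eq_right.2 (Set.inter_subset_left.trans (disjointed_subset _ i))
    simp only [this]
    rw [← Set.iUnion_inter, iUnion_disjointed, Set.inter_eq_right.2 hsub]
  have := indicatorConstLp_iUnion_mem hM
    (f := fun i => A i ×ˢ B i ∩ (disjointed (fun i => A i ×ˢ B i) i ∩ S))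
    (fun i j hij => (disjoint_disjointed (fun i => A i ×ˢ B i) hij).mono
      (Set.inter_subset_right.trans Set.inter_subset_left)
      (Set.inter_subset_right.trans Set.inter_subset_left))
    (fun i => (hR i).inter ((hD i).inter hS))
    (fun i hi => key _ _ (hA i) (hB i) (hlt i) _ ((hD i).inter hS) hi) (by rwa [← e])
  convert this

end IndicatorSpan

/-! ### Amplified operators, completions and the projective norm -/

section Amplification

variable {L : Type*} [NormedAddCommGroup L] [InnerProductSpace ℂ L]

theorem ampMap_ampMul {E F : Type*} [AddCommGroup E] [Module ℂ E] [AddCommGroup F] [Module ℂ F]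
    (φ : E →ₗ[ℂ] F) (a b : L →L[ℂ] L) (u : Amp L E) :
    ampMap L φ (ampMul a b u) = ampMul a b (ampMap L φ u) := by
  induction u using Amp.induction_on with
  | zero => simp
  | add u v hu hv => simp only [map_add, hu, hv]
  | elem c x => rfl

theorem ampMap_comp {E F G : Type*} [AddCommGroup E] [Module ℂ E] [AddCommGroup F] [Module ℂ F]
    [AddCommGroup G] [Module ℂ G] (ψ : F →ₗ[ℂ] G) (φ : E →ₗ[ℂ] F) (u : Amp L E) :
    ampMap L (ψ ∘ₗ φ) u = ampMap L ψ (ampMap L φ u) := by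
  induction u using Amp.induction_on with
  | zero => simp
  | add u v hu hv => simp only [map_add, hu, hv]
  | elem c x => rfl

theorem ampMap_zero {E F : Type*} [AddCommGroup E] [Module ℂ E] [AddCommGroup F] [Module ℂ F]
    (u : Amp L E) : ampMap L (0 : E →ₗ[ℂ] F) u = 0 := by
  induction u using Amp.induction_on with
  | zero => simp
  | add u v hu hv => simp only [map_add, hu, hv, add_zero]
  | elem c x => simp

theorem ampMul_id {E : Type*} [AddCommGroup E] [Module ℂ E] (u : Amp L E) :
    ampMul (.id ℂ L) (.id ℂ L) u = u := by
  induction u using Amp.induction_on with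
  | zero => simp
  | add u v hu hv => simp only [map_add, hu, hv]
  | elem c x => rfl

section PopAlgebra

variable (ι : Completion (L ⊗[ℂ] L) ≃ₗᵢ[ℂ] L)
  {E F E' F' : Type*} [AddCommGroup E] [Module ℂ E] [AddCommGroup F] [Module ℂ F]
  [AddCommGroup E'] [Module ℂ E'] [AddCommGroup F'] [Module ℂ F']

/-- The tensor product of two linear operators. -/
def popMap (φ : E →ₗ[ℂ] E') (ψ : F →ₗ[ℂ] F') : Pop ι E F →ₗ[ℂ] Pop ι E' F' :=
  TensorProduct.map φ ψ

@[simp] theorem popMap_tmul (φ : E →ₗ[ℂ] E') (ψ : F →ₗ[ℂ] F') (x : E) (y : F) :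
    popMap ι φ ψ (Pop.tmul ι x y) = Pop.tmul ι (φ x) (ψ y) := rfl

theorem Amp.exists_eq_sum_tmul (U : Amp L (Pop ι E F)) :
    ∃ (n : ℕ) (a : Fin n → FinRank L) (x : Fin n → E) (y : Fin n → F),
      U = ∑ k, elem (a k) (Pop.tmul ι (x k) (y k)) := by
  induction U using Amp.induction_on with
  | zero => exact ⟨0, Fin.elim0, Fin.elim0, Fin.elim0, by simp⟩
  | add U V hU hV =>
    obtain ⟨n, a, x, y, rfl⟩ := hU
    obtain ⟨m, b, z, w, rfl⟩ := hV
    exact ⟨n + m, Fin.append a b, Fin.append x z, Fin.append y w, by simp [Fin.sum_univ_add]⟩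
  | elem c w =>
    induction w using Pop.induction_on with
    | zero => exact ⟨0, Fin.elim0, Fin.elim0, Fin.elim0, by simp⟩
    | add w w' h h' =>
      obtain ⟨n, a, x, y, h⟩ := h
      obtain ⟨m, b, z, t, h'⟩ := h'
      exact ⟨n + m, Fin.append a b, Fin.append x z, Fin.append y t, by
        simp [Fin.sum_univ_add, h, h']⟩
    | tmul x y => exact ⟨1, fun _ => c, fun _ => x, fun _ => y, by simp⟩

theorem ampMap_popMap_diaAmp [CompleteSpace L] (φ : E →ₗ[ℂ] E') (ψ : F →ₗ[ℂ] F')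
    (u : Amp L E) (v : Amp L F) :
    ampMap L (popMap ι φ ψ) (diaAmp ι u v) = diaAmp ι (ampMap L φ u) (ampMap L ψ v) := by
  induction u using Amp.induction_on with
  | zero => simp
  | add u u' hu hu' => simp only [map_add, LinearMap.add_apply, hu, hu']
  | elem a x =>
    induction v using Amp.induction_on with
    | zero => simp
    | add v v' hv hv' => simp only [map_add, hv, hv']
    | elem b y => rfl

end PopAlgebra

variable [Nontrivial L]

theorem IsCompletelyIsometric.norm_map {E G : Type*} [SeminormedAddCommGroup E] [NormedSpace ℂ E]
    [PQSpace L E] [SeminormedAddCommGroup G] [NormedSpace ℂ G] [PQSpace L G] {φ : E →ₗ[ℂ] G}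
    (h : IsCompletelyIsometric L φ) (x : E) : ‖φ x‖ = ‖x‖ := by
  obtain ⟨e, he⟩ := exists_unit L
  have := h (elem (rankOne e e) x)
  rwa [ampMap_elem, PQSpace.pq_rankOne _ _ he he, PQSpace.pq_rankOne _ _ he he] at this

variable [CompleteSpace L]

section

variable {E G : Type*} [SeminormedAddCommGroup E] [NormedSpace ℂ E] [PQSpace L E]
  [SeminormedAddCommGroup G] [NormedSpace ℂ G] [PQSpace L G]

/-- The embedding of a proto-quantum space in its completion, as a linear map. -/
def toComplₗ (E : Type*) [SeminormedAddCommGroup E] [NormedSpace ℂ E] : E →ₗ[ℂ] Completion E :=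
  (Completion.toComplL (𝕜 := ℂ) (E := E)).toLinearMap

@[simp] theorem toComplₗ_apply (x : E) : toComplₗ E x = (x : Completion E) := rfl

theorem amplCompl_ampMap_coe (u : Amp L E) :
    amplCompl L E (ampMap L (toComplₗ E) u) = (u : Completion (Amp L E)) := by
  induction u using Amp.induction_on with
  | zero => rw [map_zero, map_zero, Completion.coe_zero]
  | add u v hu hv => simp only [map_add, hu, hv, Completion.coe_add]
  | elem c x =>
    rw [ampMap_elem, amplCompl_tmul, toComplₗ_apply, ContinuousLinearMap.completion_apply_coe,
      tmulL_apply]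

theorem isCompletelyIsometric_coe : IsCompletelyIsometric L (toComplₗ E) := fun u => by
  change ‖amplCompl L E (ampMap L (toComplₗ E) u)‖ = _
  rw [amplCompl_ampMap_coe, Completion.norm_coe, norm_eq_pq]

/-- A bounded operator on the completion is completely isometric if it is so on the original
space. -/
theorem IsCompletelyIsometric.of_comp_coe {φ : Completion E →L[ℂ] G}
    (h : IsCompletelyIsometric L (φ.toLinearMap ∘ₗ toComplₗ E)) :
    IsCompletelyIsometric L φ.toLinearMap := by
  -- The amplification of `φ` is not yet known to be bounded, so `u` and its image are approximated
  -- simultaneously. On an elementary tensor `a z` this is possible because `w ↦ a w` and `w ↦ a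
  -- φ(w)` are both continuous.
  have key : ∀ (u : Amp L (Completion E)) (ε : ℝ), 0 < ε → ∃ v : Amp L E,
      ‖u - ampMap L (toComplₗ E) v‖ < ε ∧
      ‖ampMap L φ.toLinearMap (u - ampMap L (toComplₗ E) v)‖ < ε := by
    intro u
    induction u using Amp.induction_on with
    | zero => exact fun ε hε => ⟨0, by simpa using hε, by simpa using hε⟩
    | add u u' hu hu' =>
      intro ε hε
      obtain ⟨v, h1, h2⟩ := hu (ε / 2) (half_pos hε)
      obtain ⟨v', h3, h4⟩ := hu' (ε / 2) (half_pos hε)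
      have e : u + u' - ampMap L (toComplₗ E) (v + v') =
          (u - ampMap L (toComplₗ E) v) + (u' - ampMap L (toComplₗ E) v') := by
        rw [map_add]; abel
      refine ⟨v + v', ?_, ?_⟩
      · rw [e]
        linarith [norm_add_le (u - ampMap L (toComplₗ E) v) (u' - ampMap L (toComplₗ E) v')]
      · rw [e, map_add]
        linarith [norm_add_le (ampMap L φ.toLinearMap (u - ampMap L (toComplₗ E) v))
          (ampMap L φ.toLinearMap (u' - ampMap L (toComplₗ E) v'))]
    | elem a z =>
      intro ε hε
      have hopen : IsOpen {w : Completion E | ‖tmulL (Completion E) a (z - w)‖ < ε ∧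
          ‖tmulL G a (φ (z - w))‖ < ε} :=
        IsOpen.and (isOpen_lt (by fun_prop) continuous_const)
          (isOpen_lt (by fun_prop) continuous_const)
      obtain ⟨x, h1, h2⟩ := Completion.denseRange_coe.exists_mem_open hopen
        ⟨z, by simpa using hε⟩
      have e : elem a z - ampMap L (toComplₗ E) (elem a x) = elem a (z - (x : Completion E)) := by
        rw [ampMap_elem, map_sub, toComplₗ_apply]
      refine ⟨elem a x, ?_, ?_⟩
      · rw [e]; exact h1
      · rw [e]; exact h2
  intro u
  rw [← norm_eq_pq, ← norm_eq_pq]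
  refine eq_of_forall_dist_le fun ε hε => ?_
  obtain ⟨v, h1, h2⟩ := key u (ε / 2) (half_pos hε)
  have h3 : ‖ampMap L φ.toLinearMap (ampMap L (toComplₗ E) v)‖ = ‖ampMap L (toComplₗ E) v‖ := by
    have := h v
    rw [ampMap_comp, ← isCompletelyIsometric_coe v] at this
    exact this
  rw [map_sub] at h2
  have h4 := abs_norm_sub_norm_le (ampMap L φ.toLinearMap u)
    (ampMap L φ.toLinearMap (ampMap L (toComplₗ E) v))
  have h5 := abs_norm_sub_norm_le u (ampMap L (toComplₗ E) v)
  rw [h3] at h4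
  rw [Real.dist_eq, abs_le]
  rw [abs_le] at h4 h5
  constructor <;> linarith [h4.1, h4.2, h5.1, h5.2]

end

section Pop

variable (ι : Completion (L ⊗[ℂ] L) ≃ₗᵢ[ℂ] L)
  {E F : Type*} [SeminormedAddCommGroup E] [NormedSpace ℂ E] [PQSpace L E]
  [SeminormedAddCommGroup F] [NormedSpace ℂ F] [PQSpace L F]
  {E' F' : Type*} [SeminormedAddCommGroup E'] [NormedSpace ℂ E'] [PQSpace L E']
  [SeminormedAddCommGroup F'] [NormedSpace ℂ F'] [PQSpace L F']

/-- The identity operators give a representation with a single term. -/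
theorem norm_diaAmp_le (u : Amp L E) (v : Amp L F) : ‖diaAmp ι u v‖ ≤ ‖u‖ * ‖v‖ := by
  refine (csInf_le (popValues_bddBelow ι _) ⟨1, fun _ => .id ℂ L, fun _ => .id ℂ L, fun _ => u,
    fun _ => v, ?_, rfl⟩).trans_eq ?_
  · simp [ampMul_id]
  · simp [norm_eq_pq]

/-- The operation `⋄` turns a pair of rank one operators of norm one into another, so the bound for
`u ⋄ v` descends to the underlying semi-norms. -/
theorem norm_tmul_le (x : E) (y : F) : ‖Pop.tmul ι x y‖ ≤ ‖x‖ * ‖y‖ := by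
  obtain ⟨e, he⟩ := exists_unit L
  have hd : ‖dia ι e e‖ = 1 := by rw [norm_dia, he, one_mul]
  have h := norm_diaAmp_le ι (elem (rankOne e e) x) (elem (rankOne e e) y)
  have e1 : diaFin ι (rankOne e e) (rankOne e e) = rankOne (dia ι e e) (dia ι e e) :=
    FinRank.toCLM_injective (diaOp_rankOne ι e e e e)
  rw [diaAmp_elem, e1] at h
  simpa only [norm_eq_pq, PQSpace.pq_rankOne _ _ he he, PQSpace.pq_rankOne _ _ hd hd] using h

/-- The bounded bilinear operator `(x, y) ↦ x ⊗ y`. -/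
def tmulB (E F : Type*) [SeminormedAddCommGroup E] [NormedSpace ℂ E] [PQSpace L E]
    [SeminormedAddCommGroup F] [NormedSpace ℂ F] [PQSpace L F] : E →L[ℂ] F →L[ℂ] Pop ι E F :=
  LinearMap.mkContinuous₂ (Pop.tmul ι) 1 fun x y => by
    rw [one_mul]; exact norm_tmul_le ι x y

/-- Complete bounds multiply: the amplified map commutes with outer multiplications and respects
`⋄`, so it carries every representation of `U` to one of its image, at a cost of at most the factor
`c * d`. -/
theorem norm_ampMap_popMap_le {φ : E →ₗ[ℂ] E'} {ψ : F →ₗ[ℂ] F'} {c d : ℝ}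
    (hc : 0 ≤ c) (hd : 0 ≤ d) (hφ : ∀ u : Amp L E, ‖ampMap L φ u‖ ≤ c * ‖u‖)
    (hψ : ∀ v : Amp L F, ‖ampMap L ψ v‖ ≤ d * ‖v‖) (U : Amp L (Pop ι E F)) :
    ‖ampMap L (popMap ι φ ψ) U‖ ≤ c * d * ‖U‖ := by
  rw [norm_eq_pq U]
  change _ ≤ _ * sInf (popValues ι U)
  rw [← smul_eq_mul, ← Real.sInf_smul_of_nonneg (by positivity)]
  refine le_csInf (popValues_nonempty ι U).smul_set ?_
  rintro _ ⟨_, ⟨n, a, b, u, v, rfl, rfl⟩, rfl⟩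
  simp only [smul_eq_mul, map_sum, Finset.mul_sum]
  refine (norm_sum_le _ _).trans (Finset.sum_le_sum fun k _ => ?_)
  rw [ampMap_ampMul, ampMap_popMap_diaAmp]
  refine (PQSpace.pq_ampMul_le _ _ _).trans ?_
  have h1 := norm_diaAmp_le ι (ampMap L φ (u k)) (ampMap L ψ (v k))
  calc _ ≤ ‖a k‖ * (c * ‖u k‖ * (d * ‖v k‖)) * ‖b k‖ := by
        gcongr
        refine h1.trans ?_
        gcongr
        · exact hφ _
        · exact hψ _
    _ = _ := by simp only [norm_eq_pq]; ring

end Pop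

end Amplification

/-! ### The complete isometry on the uncompleted tensor product -/

section TensorLp

variable {X Y : Type*} [MeasurableSpace X] [MeasurableSpace Y] {μ : Measure X} {ν : Measure Y}

theorem lintegral_enorm_mul_enorm {G H : Type*} [NormedAddCommGroup G] [NormedAddCommGroup H]
    (u : Lp G 1 μ) (v : Lp H 1 ν) :
    ∫⁻ p, ‖u p.1‖ₑ * ‖v p.2‖ₑ ∂prodMeasure μ ν = ‖u‖ₑ * ‖v‖ₑ := by
  rw [lintegral_mul_prodMeasure (Lp.stronglyMeasurable u).enorm (Lp.stronglyMeasurable v).enorm,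
    Lp.enorm_def, Lp.enorm_def, eLpNorm_one_eq_lintegral_enorm, eLpNorm_one_eq_lintegral_enorm]

/-- The operator taking a vector `x` to the function equal to `x` on the set `A` and to `0` outside
`A`. It is zero if `A` has infinite measure. -/
def indicatorLp (μ : Measure X) (E : Type*) [NormedAddCommGroup E] [NormedSpace ℂ E] {A : Set X}
    (hA : MeasurableSet A) : E →ₗ[ℂ] Lp E 1 μ :=
  open Classical in
  if h : μ A ≠ ∞ then
    { toFun := indicatorConstLp 1 hA h
      map_add' := fun x y => indicatorConstLp_add.symm
      map_smul' := fun c x => by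
        ext1
        filter_upwards [indicatorConstLp_coeFn (p := 1) (hs := hA) (hμs := h) (c := c • x),
          indicatorConstLp_coeFn (p := 1) (hs := hA) (hμs := h) (c := x),
          Lp.coeFn_smul c (indicatorConstLp 1 hA h x)] with s h1 h2 h3
        rw [h1, RingHom.id_apply, h3, Pi.smul_apply, h2, Set.indicator_const_smul_apply] }
  else 0

theorem indicatorLp_apply {E : Type*} [NormedAddCommGroup E] [NormedSpace ℂ E] {A : Set X}
    (hA : MeasurableSet A) (h : μ A ≠ ∞) (x : E) :
    indicatorLp μ E hA x = indicatorConstLp 1 hA h x := by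
  rw [indicatorLp, dif_pos h]; rfl

variable {L : Type*} [NormedAddCommGroup L] [InnerProductSpace ℂ L] [Nontrivial L]
  [CompleteSpace L] (ι : Completion (L ⊗[ℂ] L) ≃ₗᵢ[ℂ] L)
  {E F : Type*} [NormedAddCommGroup E] [NormedSpace ℂ E] [PQSpace L E]
  [NormedAddCommGroup F] [NormedSpace ℂ F] [PQSpace L F]

theorem amplLp_ampMap_indicatorLp {A : Set X} (hA : MeasurableSet A) (h : μ A ≠ ∞)
    (u : Amp L E) :
    amplLp L E 1 μ (ampMap L (indicatorLp μ E hA) u) = indicatorConstLp 1 hA h u := by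
  rw [← indicatorLp_apply hA h]
  induction u using Amp.induction_on with
  | zero => simp only [map_zero]
  | add u v hu hv => simp only [map_add, hu, hv]
  | elem a x =>
    rw [ampMap_elem, amplLp_tmul, indicatorLp_apply hA h, indicatorLp_apply hA h]
    ext1
    filter_upwards [(tmulL E a).coeFn_compLp (indicatorConstLp 1 hA h x),
      indicatorConstLp_coeFn (p := 1) (hs := hA) (hμs := h) (c := x),
      indicatorConstLp_coeFn (p := 1) (hs := hA) (hμs := h) (c := elem a x)] with s h1 h2 h3
    rw [h1, h2, h3]
    by_cases hs : s ∈ A <;> simp [hs]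

/-- The amplified operator sends `u` to the function equal to `u` on `A`, of norm `μ(A) ‖u‖`. If `A`
has infinite measure, both the operator and `μ.real A` take the default value zero. -/
theorem norm_ampMap_indicatorLp_le {A : Set X} (hA : MeasurableSet A) (u : Amp L E) :
    ‖ampMap L (indicatorLp μ E hA) u‖ ≤ μ.real A * ‖u‖ := by
  by_cases h : μ A ≠ ∞
  · change ‖amplLp L E 1 μ (ampMap L (indicatorLp μ E hA) u)‖ ≤ _
    rw [amplLp_ampMap_indicatorLp hA h, norm_indicatorConstLp one_ne_zero ENNReal.one_ne_top]
    simp [mul_comm]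
  · have : ampMap L (indicatorLp μ E hA) u = 0 := by
      rw [indicatorLp, dif_neg h, ampMap_zero]
    rw [this, norm_zero]
    positivity

/-- A fibre of infinite measure contributes nothing: by integrability of `x` the coordinate `v k`
vanishes there, so the default value of `indicatorLp` does no harm. -/
theorem eq_sum_indicatorLp {n : ℕ} (g : SimpleFunc X (Fin n → E)) {k : Fin n} {x : Lp E 1 μ}
    (hx : x =ᵐ[μ] fun s => g s k) :
    x = ∑ v ∈ g.range, indicatorLp μ E (g.measurableSet_fiber v) (v k) := by
  classical
  have hmem : MemLp (g.map fun v => v k) 1 μ := (memLp_congr_ae hx).1 (Lp.memLp x)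
  have hfin : ∀ v : Fin n → E, v k ≠ 0 → μ (g ⁻¹' {v}) ≠ ∞ := fun v hv =>
    measure_ne_top_of_subset (fun s hs => by
      simp only [Set.mem_preimage, Set.mem_singleton_iff] at hs
      simp [hs])
      (SimpleFunc.measure_preimage_lt_top_of_memLp one_ne_zero ENNReal.one_ne_top _ hmem
        (v k) hv).ne
  have hae : ∀ v : Fin n → E, indicatorLp μ E (g.measurableSet_fiber v) (v k) =ᵐ[μ]
      (g ⁻¹' {v}).indicator fun _ => v k := by
    intro v
    by_cases hv : v k = 0
    · rw [hv, map_zero]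
      filter_upwards [Lp.coeFn_zero E 1 μ] with s hs
      rw [hs]; simp
    · rw [indicatorLp_apply _ (hfin v hv)]
      exact indicatorConstLp_coeFn
  ext1
  have h1 := (ae_ball_iff g.range.countable_toSet).2 fun v _ => hae v
  filter_upwards [hx, h1, Lp.coeFn_finsetSum g.range fun v =>
    indicatorLp μ E (g.measurableSet_fiber v) (v k)] with s h2 h3 h4
  rw [h2, h4, Finset.sum_apply, Finset.sum_congr rfl fun v hv => h3 v hv,
    Finset.sum_eq_single (g s)]
  · simp
  · intro v _ hv
    simp [hv.symm]
  · exact fun h => (h (g.mem_range_self s)).elim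

theorem exists_simpleFunc_pi {E : Type*} {n : ℕ} (f : Fin n → SimpleFunc X E) :
    ∃ g : SimpleFunc X (Fin n → E), ∀ s k, g s k = f k s :=
  ⟨{  toFun := fun s k => f k s
      measurableSet_fiber' := fun v => by
        have : (fun s k => f k s) ⁻¹' {v} = ⋂ k, f k ⁻¹' {v k} := by
          ext s; simp [funext_iff]
        rw [this]
        exact MeasurableSet.iInter fun k => (f k).measurableSet_fiber _
      finite_range' := (Set.Finite.pi' fun k => (f k).finite_range).subset (by
        rintro _ ⟨s, rfl⟩ k
        exact Set.mem_range_self s) }, fun _ _ => rfl⟩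

/-- A single simple function with values in tuples provides one partition adapted to all `x k` at
once. -/
theorem dense_simpleFunc_pi {E : Type*} [NormedAddCommGroup E] (n : ℕ) :
    Dense {x : Fin n → Lp E 1 μ |
      ∃ g : SimpleFunc X (Fin n → E), ∀ k, x k =ᵐ[μ] fun s => g s k} := by
  have := dense_pi (s := fun _ : Fin n => {x : Lp E 1 μ | ∃ g : SimpleFunc X E, x =ᵐ[μ] g})
    Set.univ fun k _ => ?_
  · refine this.mono fun x hx => ?_
    choose f hf using fun k => hx k (Set.mem_univ k)
    obtain ⟨g, hg⟩ := exists_simpleFunc_pi f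
    refine ⟨g, fun k => (hf k).trans (Filter.Eventually.of_forall fun s => (hg s k).symm)⟩
  · refine (Lp.simpleFunc.denseRange ENNReal.one_ne_top).mono ?_
    rintro _ ⟨f, rfl⟩
    exact ⟨_, (Lp.simpleFunc.toSimpleFunc_eq_toFun f).symm⟩

theorem memLp_tmul (x : Lp E 1 μ) (y : Lp F 1 ν) :
    MemLp (fun p : X × Y => ((Pop.tmul ι (x p.1) (y p.2) : Pop ι E F) : Completion (Pop ι E F))) 1
      (prodMeasure μ ν) := by
  refine ⟨?_, ?_⟩
  · have hc : Continuous fun q : E × F =>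
        ((tmulB ι E F q.1 q.2 : Pop ι E F) : Completion (Pop ι E F)) :=
      (Completion.continuous_coe _).comp (by fun_prop)
    have hxy : StronglyMeasurable fun p : X × Y => (x p.1, y p.2) :=
      ((Lp.stronglyMeasurable x).comp_measurable measurable_fst).prodMk
        ((Lp.stronglyMeasurable y).comp_measurable measurable_snd)
    exact (hc.comp_stronglyMeasurable hxy).aestronglyMeasurable
  · rw [eLpNorm_one_eq_lintegral_enorm]
    refine (lintegral_mono fun p => ?_).trans_lt
      ((lintegral_enorm_mul_enorm x y).trans_lt (ENNReal.mul_lt_top enorm_lt_top enorm_lt_top))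
    rw [← ofReal_norm, ← ofReal_norm, ← ofReal_norm, ← ENNReal.ofReal_mul (norm_nonneg _),
      Completion.norm_coe]
    exact ENNReal.ofReal_le_ofReal (norm_tmul_le ι _ _)

/-- The bilinear operator taking `x` and `y` to the function `(s, t) ↦ x s ⊗ y t`. -/
def tensorLp (μ : Measure X) (ν : Measure Y) (E F : Type*) [NormedAddCommGroup E]
    [NormedSpace ℂ E] [PQSpace L E] [NormedAddCommGroup F] [NormedSpace ℂ F] [PQSpace L F] :
    Lp E 1 μ →ₗ[ℂ] Lp F 1 ν →ₗ[ℂ] Lp (Completion (Pop ι E F)) 1 (prodMeasure μ ν) :=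
  LinearMap.mk₂ ℂ (fun x y => (memLp_tmul ι x y).toLp _)
    (fun x x' y => by
      rw [← MemLp.toLp_add]
      refine MemLp.toLp_congr _ _ ?_
      filter_upwards [ae_prodMeasure_fst (Lp.coeFn_add x x')] with p hp
      rw [hp]
      simp [Completion.coe_add])
    (fun c x y => by
      rw [← MemLp.toLp_const_smul]
      refine MemLp.toLp_congr _ _ ?_
      filter_upwards [ae_prodMeasure_fst (Lp.coeFn_smul c x)] with p hp
      rw [hp]
      simp [Completion.coe_smul])
    (fun x y y' => by
      rw [← MemLp.toLp_add]
      refine MemLp.toLp_congr _ _ ?_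
      filter_upwards [ae_prodMeasure_snd (Lp.coeFn_add y y')] with p hp
      rw [hp]
      simp [Completion.coe_add])
    (fun c x y => by
      rw [← MemLp.toLp_const_smul]
      refine MemLp.toLp_congr _ _ ?_
      filter_upwards [ae_prodMeasure_snd (Lp.coeFn_smul c y)] with p hp
      rw [hp]
      simp [Completion.coe_smul])

theorem coeFn_tensorLp (x : Lp E 1 μ) (y : Lp F 1 ν) :
    tensorLp ι μ ν E F x y =ᵐ[prodMeasure μ ν] fun p =>
      ((Pop.tmul ι (x p.1) (y p.2) : Pop ι E F) : Completion (Pop ι E F)) :=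
  MemLp.coeFn_toLp (memLp_tmul ι x y)

/-- The linear operator taking `x ⊗ y` to the function `(s, t) ↦ x s ⊗ y t`. -/
def popLp (μ : Measure X) (ν : Measure Y) (E F : Type*) [NormedAddCommGroup E]
    [NormedSpace ℂ E] [PQSpace L E] [NormedAddCommGroup F] [NormedSpace ℂ F] [PQSpace L F] :
    Pop ι (Lp E 1 μ) (Lp F 1 ν) →ₗ[ℂ] Lp (Completion (Pop ι E F)) 1 (prodMeasure μ ν) :=
  TensorProduct.lift (tensorLp ι μ ν E F)

@[simp] theorem popLp_tmul (x : Lp E 1 μ) (y : Lp F 1 ν) :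
    popLp ι μ ν E F (Pop.tmul ι x y) = tensorLp ι μ ν E F x y :=
  TensorProduct.lift.tmul x y

theorem coeFn_amplLp_popLp_elem (a : FinRank L) (x : Lp E 1 μ) (y : Lp F 1 ν) :
    amplLp L (Completion (Pop ι E F)) 1 (prodMeasure μ ν)
      (ampMap L (popLp ι μ ν E F) (elem a (Pop.tmul ι x y)))
      =ᵐ[prodMeasure μ ν] fun p => ampMap L (toComplₗ (Pop ι E F))
        (elem a (Pop.tmul ι (x p.1) (y p.2))) := by
  rw [ampMap_elem, popLp_tmul, amplLp_tmul]
  filter_upwards [(tmulL (Completion (Pop ι E F)) a).coeFn_compLp (tensorLp ι μ ν E F x y),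
    coeFn_tensorLp ι x y]
    with p h1 h2
  rw [h1, h2]
  rfl

/-- The operation `⋄` is computed pointwise. Both sides are bilinear in `u` and `v`, so elementary
tensors suffice. The embedding `toComplₗ` appears because the functions take values in the completed
tensor product. -/
theorem coeFn_amplLp_popLp_diaAmp (u : Amp L (Lp E 1 μ)) (v : Amp L (Lp F 1 ν)) :
    amplLp L (Completion (Pop ι E F)) 1 (prodMeasure μ ν)
      (ampMap L (popLp ι μ ν E F) (diaAmp ι u v))
      =ᵐ[prodMeasure μ ν] fun p => ampMap L (toComplₗ (Pop ι E F))
        (diaAmp ι (amplLp L E 1 μ u p.1) (amplLp L F 1 ν v p.2)) := by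
  induction u using Amp.induction_on with
  | zero =>
    simp only [map_zero, LinearMap.zero_apply]
    filter_upwards [ae_prodMeasure_fst (Lp.coeFn_zero (Amp L E) 1 μ), 
      Lp.coeFn_zero (Amp L (Completion (Pop ι E F))) 1 (prodMeasure μ ν)]
      with p h1 h2
    rw [h1, h2]
    simp
  | add u u' hu hu' =>
    simp only [map_add, LinearMap.add_apply]
    filter_upwards [hu, hu', Lp.coeFn_add (amplLp L (Completion (Pop ι E F)) 1 (prodMeasure μ ν)
      (ampMap L (popLp ι μ ν E F) (diaAmp ι u v)))
      (amplLp L (Completion (Pop ι E F)) 1 (prodMeasure μ ν)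
      (ampMap L (popLp ι μ ν E F) (diaAmp ι u' v))),
      ae_prodMeasure_fst (Lp.coeFn_add (amplLp L E 1 μ u) (amplLp L E 1 μ u'))] with p h1 h2 h3 h4
    rw [h3, h4, Pi.add_apply, Pi.add_apply, h1, h2]
    simp only [map_add, LinearMap.add_apply]
  | elem a x =>
    induction v using Amp.induction_on with
    | zero =>
      simp only [map_zero]
      filter_upwards [ae_prodMeasure_snd (Lp.coeFn_zero (Amp L F) 1 ν), 
      Lp.coeFn_zero (Amp L (Completion (Pop ι E F))) 1 (prodMeasure μ ν)]
        with p h1 h2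
      rw [h1, h2]
      simp
    | add v v' hv hv' =>
      simp only [map_add]
      filter_upwards [hv, hv', Lp.coeFn_add (amplLp L (Completion (Pop ι E F)) 1 (prodMeasure μ ν)
        (ampMap L (popLp ι μ ν E F) (diaAmp ι (elem a x) v)))
        (amplLp L (Completion (Pop ι E F)) 1 (prodMeasure μ ν)
        (ampMap L (popLp ι μ ν E F) (diaAmp ι (elem a x) v'))),
        ae_prodMeasure_snd (Lp.coeFn_add (amplLp L F 1 ν v) (amplLp L F 1 ν v'))]
        with p h1 h2 h3 h4
      rw [h3, h4, Pi.add_apply, Pi.add_apply, h1, h2]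
      simp only [map_add]
    | elem b y =>
      rw [diaAmp_elem, amplLp_tmul, amplLp_tmul]
      filter_upwards [coeFn_amplLp_popLp_elem ι (diaFin ι a b) x y,
        ae_prodMeasure_fst ((tmulL E a).coeFn_compLp x),
        ae_prodMeasure_snd ((tmulL F b).coeFn_compLp y)] with p h1 h2 h3
      rw [h1, h2, h3, tmulL_apply, tmulL_apply, diaAmp_elem]

/-- The pointwise estimate `‖u s ⋄ v t‖ ≤ ‖u s‖ ‖v t‖` is integrated over the product. -/
theorem norm_ampMap_popLp_diaAmp_le (u : Amp L (Lp E 1 μ)) (v : Amp L (Lp F 1 ν)) :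
    ‖ampMap L (popLp ι μ ν E F) (diaAmp ι u v)‖ ≤ ‖u‖ * ‖v‖ := by
  change ‖amplLp L (Completion (Pop ι E F)) 1 (prodMeasure μ ν)
    (ampMap L (popLp ι μ ν E F) (diaAmp ι u v))‖ ≤
    ‖amplLp L E 1 μ u‖ * ‖amplLp L F 1 ν v‖
  rw [← toReal_enorm, ← toReal_enorm (amplLp L E 1 μ u), ← toReal_enorm (amplLp L F 1 ν v),
    ← ENNReal.toReal_mul]
  refine ENNReal.toReal_mono (ENNReal.mul_lt_top enorm_lt_top enorm_lt_top).ne ?_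
  rw [← lintegral_enorm_mul_enorm, Lp.enorm_def, eLpNorm_one_eq_lintegral_enorm]
  refine lintegral_mono_ae ?_
  filter_upwards [coeFn_amplLp_popLp_diaAmp ι u v] with p hp
  rw [hp, ← ofReal_norm, ← ofReal_norm, ← ofReal_norm, ← ENNReal.ofReal_mul (norm_nonneg _)]
  refine ENNReal.ofReal_le_ofReal ?_
  exact (isCompletelyIsometric_coe (E := Pop ι E F) _).le.trans (norm_diaAmp_le ι _ _)

/-- The projective norm dominates every contractive bimodule semi-norm satisfying `‖u ⋄ v‖ ≤ ‖u‖
‖v‖`, in particular the one pulled back from `L_1`. -/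
theorem norm_ampMap_popLp_le (U : Amp L (Pop ι (Lp E 1 μ) (Lp F 1 ν))) :
    ‖ampMap L (popLp ι μ ν E F) U‖ ≤ ‖U‖ := by
  refine le_csInf (popValues_nonempty ι U) ?_
  rintro _ ⟨n, a, b, u, v, rfl, rfl⟩
  rw [map_sum]
  refine (norm_sum_le (E := Amp L (Lp (Completion (Pop ι E F)) 1 (prodMeasure μ ν))) _ _).trans
    (Finset.sum_le_sum fun k _ => ?_)
  rw [ampMap_ampMul]
  refine (PQSpace.pq_ampMul_le (E := Lp (Completion (Pop ι E F)) 1 (prodMeasure μ ν)) _ _ _).trans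
    ?_
  rw [mul_assoc ‖a k‖ (PQSpace.pq (u k))]
  gcongr
  exact norm_ampMap_popLp_diaAmp_le ι _ _

theorem lintegral_simpleFunc_prod {V W : Type*} (g : SimpleFunc X V) (h : SimpleFunc Y W)
    (N : V → W → ℝ≥0∞) :
    ∫⁻ p, N (g p.1) (h p.2) ∂prodMeasure μ ν =
      ∑ v ∈ g.range, ∑ w ∈ h.range, N v w * (μ (g ⁻¹' {v}) * ν (h ⁻¹' {w})) := by
  classical
  have hR : ∀ v w, MeasurableSet ((g ⁻¹' {v}) ×ˢ (h ⁻¹' {w})) := fun v w =>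
    (g.measurableSet_fiber v).prod (h.measurableSet_fiber w)
  have e : ∀ p : X × Y, N (g p.1) (h p.2) = ∑ v ∈ g.range, ∑ w ∈ h.range,
      ((g ⁻¹' {v}) ×ˢ (h ⁻¹' {w})).indicator (fun _ => N v w) p := by
    intro p
    rw [Finset.sum_eq_single (g p.1), Finset.sum_eq_single (h p.2)]
    · simp
    · intro w _ hw
      simp [hw.symm]
    · exact fun hh => (hh (h.mem_range_self _)).elim
    · intro v _ hv
      simp [hv.symm]
    · exact fun hh => (hh (g.mem_range_self _)).elim
  simp_rw [e]
  have hm : ∀ v w, Measurable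
      (((g ⁻¹' {v}) ×ˢ (h ⁻¹' {w})).indicator (fun _ => N v w) : X × Y → ℝ≥0∞) :=
    fun v w => measurable_const.indicator (hR v w)
  rw [lintegral_finsetSum _ fun v _ => Finset.measurable_sum _ fun w _ => hm v w]
  refine Finset.sum_congr rfl fun v _ => ?_
  rw [lintegral_finsetSum _ fun w _ => hm v w]
  refine Finset.sum_congr rfl fun w _ => ?_
  rw [lintegral_indicator_const (hR v w),
    prodMeasure_prod (g.measurableSet_fiber v) (h.measurableSet_fiber w)]

/-- The projective norm of an element built from simple functions is at most the norm of the
corresponding function. -/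
theorem norm_le_norm_ampMap_popLp_of_simpleFunc {n : ℕ} (a : Fin n → FinRank L)
    (g : SimpleFunc X (Fin n → E)) (h : SimpleFunc Y (Fin n → F))
    {x : Fin n → Lp E 1 μ} (hx : ∀ k, x k =ᵐ[μ] fun s => g s k)
    {y : Fin n → Lp F 1 ν} (hy : ∀ k, y k =ᵐ[ν] fun t => h t k) :
    ‖∑ k, elem (L := L) (a k) (Pop.tmul ι (x k) (y k))‖ ≤
      ‖ampMap L (popLp ι μ ν E F) (∑ k, elem (a k) (Pop.tmul ι (x k) (y k)))‖ := by
  classical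
  -- `W v w` is the value of the function on the cell where `g = v` and `h = w`.
  let W : (Fin n → E) → (Fin n → F) → Amp L (Pop ι E F) := fun v w =>
    ∑ k, elem (a k) (Pop.tmul ι (v k) (w k))
  have h1 : ∑ k, elem (L := L) (a k) (Pop.tmul ι (x k) (y k)) =
      ∑ v ∈ g.range, ∑ w ∈ h.range, ampMap L (popMap ι
        (indicatorLp μ E (g.measurableSet_fiber v)) (indicatorLp ν F (h.measurableSet_fiber w)))
        (W v w) := by
    calc _ = ∑ k, ∑ v ∈ g.range, ∑ w ∈ h.range, elem (a k) (Pop.tmul ι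
          (indicatorLp μ E (g.measurableSet_fiber v) (v k))
          (indicatorLp ν F (h.measurableSet_fiber w) (w k))) := by
          refine Finset.sum_congr rfl fun k _ => ?_
          conv_lhs => rw [eq_sum_indicatorLp g (hx k), eq_sum_indicatorLp h (hy k)]
          simp only [map_sum, LinearMap.sum_apply]
          rw [Finset.sum_comm]
      _ = _ := by
          rw [Finset.sum_comm]
          refine Finset.sum_congr rfl fun v _ => ?_
          rw [Finset.sum_comm]
          refine Finset.sum_congr rfl fun w _ => ?_
          simp only [W, map_sum, ampMap_elem, popMap_tmul]
  have h2 : amplLp L (Completion (Pop ι E F)) 1 (prodMeasure μ ν) (ampMap L (popLp ι μ ν E F)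
      (∑ k, elem (a k) (Pop.tmul ι (x k) (y k)))) =ᵐ[prodMeasure μ ν] fun p =>
      ampMap L (toComplₗ (Pop ι E F)) (W (g p.1) (h p.2)) := by
    simp only [map_sum, W]
    have h3 := ae_all_iff.2 fun k => coeFn_amplLp_popLp_elem ι (a k) (x k) (y k)
    filter_upwards [h3, ae_prodMeasure_fst (ae_all_iff.2 hx), ae_prodMeasure_snd (ae_all_iff.2 hy),
      Lp.coeFn_finsetSum Finset.univ fun k => amplLp L (Completion (Pop ι E F)) 1 (prodMeasure μ ν)
        (ampMap L (popLp ι μ ν E F) (elem (a k) (Pop.tmul ι (x k) (y k))))] with p h4 h5 h6 h7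
    rw [h7, Finset.sum_apply]
    refine Finset.sum_congr rfl fun k _ => ?_
    rw [h4, h5, h6]
  have h8 : ‖ampMap L (popLp ι μ ν E F) (∑ k, elem (a k) (Pop.tmul ι (x k) (y k)))‖ =
      ∑ v ∈ g.range, ∑ w ∈ h.range, ‖W v w‖ * (μ.real (g ⁻¹' {v}) * ν.real (h ⁻¹' {w})) := by
    change ‖amplLp L (Completion (Pop ι E F)) 1 (prodMeasure μ ν) _‖ = _
    have h9 : ‖amplLp L (Completion (Pop ι E F)) 1 (prodMeasure μ ν) (ampMap L (popLp ι μ ν E F)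
        (∑ k, elem (a k) (Pop.tmul ι (x k) (y k))))‖ₑ = ∑ v ∈ g.range, ∑ w ∈ h.range,
        ‖W v w‖ₑ * (μ (g ⁻¹' {v}) * ν (h ⁻¹' {w})) := by
      rw [← lintegral_simpleFunc_prod, Lp.enorm_def, eLpNorm_one_eq_lintegral_enorm]
      refine lintegral_congr_ae ?_
      filter_upwards [h2] with p hp
      rw [hp, ← ofReal_norm, ← ofReal_norm]
      congr 1
      exact isCompletelyIsometric_coe (E := Pop ι E F) _
    -- Finiteness of the total makes every summand finite, even on cells of infinite measure, so the
    -- identity passes to real numbers term by term.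
    have hfin := h9.symm.trans_lt enorm_lt_top
    rw [← toReal_enorm, h9, ENNReal.toReal_sum fun v hv => (ENNReal.sum_lt_top.1 hfin v hv).ne]
    refine Finset.sum_congr rfl fun v hv => ?_
    rw [ENNReal.toReal_sum fun w hw =>
      (ENNReal.sum_lt_top.1 (ENNReal.sum_lt_top.1 hfin v hv) w hw).ne]
    refine Finset.sum_congr rfl fun w hw => ?_
    rw [ENNReal.toReal_mul, ENNReal.toReal_mul, toReal_enorm, measureReal_def, measureReal_def]
  rw [h8, h1]
  refine (norm_sum_le (E := Amp L (Pop ι (Lp E 1 μ) (Lp F 1 ν))) _ _).trans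
    (Finset.sum_le_sum fun v _ => ?_)
  refine (norm_sum_le (E := Amp L (Pop ι (Lp E 1 μ) (Lp F 1 ν))) _ _).trans
    (Finset.sum_le_sum fun w _ => ?_)
  -- On each cell the tensor product of the two indicator operators has complete bound `μ(A) ν(B)`.
  rw [mul_comm ‖W v w‖]
  exact norm_ampMap_popMap_le (E := E) (F := F) (E' := Lp E 1 μ) (F' := Lp F 1 ν) ι
    measureReal_nonneg measureReal_nonneg (norm_ampMap_indicatorLp_le _)
    (norm_ampMap_indicatorLp_le _) _

/-- With the operators `a k` fixed, both norms depend continuously on the tuples `x` and `y`, so the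
lower estimate passes from tuples of simple functions to all tuples. -/
theorem isCompletelyIsometric_popLp : IsCompletelyIsometric L (popLp ι μ ν E F) := by
  intro U
  refine le_antisymm (norm_ampMap_popLp_le ι U) ?_
  obtain ⟨n, a, x, y, rfl⟩ := Amp.exists_eq_sum_tmul (E := Lp E 1 μ) (F := Lp F 1 ν) ι U
  have hT : Continuous (ampMap L (popLp ι μ ν E F)) :=
    AddMonoidHomClass.continuous_of_bound _ 1 fun U => by
      rw [one_mul]; exact norm_ampMap_popLp_le ι U
  -- Written through the bounded operators `tmulL` and `tmulB`, the element is visibly continuous in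
  -- the tuples.
  let C : (Fin n → Lp E 1 μ) × (Fin n → Lp F 1 ν) → Amp L (Pop ι (Lp E 1 μ) (Lp F 1 ν)) :=
    fun q => ∑ k, tmulL (Pop ι (Lp E 1 μ) (Lp F 1 ν)) (a k)
      (tmulB ι (Lp E 1 μ) (Lp F 1 ν) (q.1 k) (q.2 k))
  have hC : Continuous C := by fun_prop
  have hclosed : IsClosed {q | ‖C q‖ ≤ ‖ampMap L (popLp ι μ ν E F) (C q)‖} :=
    isClosed_le hC.norm (hT.comp hC).norm
  have hdense := (dense_simpleFunc_pi (μ := μ) (E := E) n).prod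
    (dense_simpleFunc_pi (μ := ν) (E := F) n)
  have := hclosed.closure_subset_iff.2 (by
    rintro q ⟨⟨g, hg⟩, h, hh⟩
    exact norm_le_norm_ampMap_popLp_of_simpleFunc ι a g h hg hh) (hdense (x, y))
  exact this

end TensorLp

/-! ### Extension to the completion and surjectivity -/

section Isomorphism

variable {X Y : Type*} [MeasurableSpace X] [MeasurableSpace Y] {μ : Measure X} {ν : Measure Y}
  {L : Type*} [NormedAddCommGroup L] [InnerProductSpace ℂ L] [Nontrivial L]
  [CompleteSpace L] (ι : Completion (L ⊗[ℂ] L) ≃ₗᵢ[ℂ] L)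
  {E F : Type*} [NormedAddCommGroup E] [NormedSpace ℂ E] [PQSpace L E]
  [NormedAddCommGroup F] [NormedSpace ℂ F] [PQSpace L F]

/-- The continuous extension of `PQ.popLp` to the completed tensor product. -/
def complPopLp (μ : Measure X) (ν : Measure Y) (E F : Type*) [NormedAddCommGroup E]
    [NormedSpace ℂ E] [PQSpace L E] [NormedAddCommGroup F] [NormedSpace ℂ F] [PQSpace L F] :
    Completion (Pop ι (Lp E 1 μ) (Lp F 1 ν)) →L[ℂ]
      Lp (Completion (Pop ι E F)) 1 (prodMeasure μ ν) :=
  (LinearMap.mkContinuous (popLp ι μ ν E F) 1 fun w =>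
    ((isCompletelyIsometric_popLp (μ := μ) (ν := ν) (E := E) (F := F) ι).norm_map w).le.trans_eq
      (one_mul _).symm).extend
    (Completion.toComplL (𝕜 := ℂ) (E := Pop ι (Lp E 1 μ) (Lp F 1 ν)))

theorem complPopLp_coe (w : Pop ι (Lp E 1 μ) (Lp F 1 ν)) :
    complPopLp ι μ ν E F (w : Completion (Pop ι (Lp E 1 μ) (Lp F 1 ν))) = popLp ι μ ν E F w :=
  ContinuousLinearMap.extend_eq _ Completion.denseRange_coe (Completion.isUniformInducing_coe _) w

theorem isCompletelyIsometric_complPopLp :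
    IsCompletelyIsometric L (complPopLp ι μ ν E F).toLinearMap := by
  apply IsCompletelyIsometric.of_comp_coe
  have : (complPopLp ι μ ν E F).toLinearMap ∘ₗ toComplₗ (Pop ι (Lp E 1 μ) (Lp F 1 ν)) =
      popLp ι μ ν E F := LinearMap.ext fun w => complPopLp_coe ι w
  rw [this]
  exact isCompletelyIsometric_popLp ι

theorem isometry_complPopLp : Isometry (complPopLp ι μ ν E F) :=
  AddMonoidHomClass.isometry_of_norm _ fun z =>
    (isCompletelyIsometric_complPopLp (μ := μ) (ν := ν) (E := E) (F := F) ι).norm_map z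

theorem tensorLp_indicatorConstLp {A : Set X} {B : Set Y} (hA : MeasurableSet A)
    (hB : MeasurableSet B) (hfA : μ A ≠ ∞) (hfB : ν B ≠ ∞) (hAB : prodMeasure μ ν (A ×ˢ B) ≠ ∞)
    (x : E) (y : F) :
    tensorLp ι μ ν E F (indicatorConstLp 1 hA hfA x) (indicatorConstLp 1 hB hfB y) =
      indicatorConstLp 1 (hA.prod hB) hAB ((Pop.tmul ι x y : Pop ι E F) :
        Completion (Pop ι E F)) := by
  ext1
  filter_upwards [coeFn_tensorLp ι (indicatorConstLp 1 hA hfA x) (indicatorConstLp 1 hB hfB y),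
    ae_prodMeasure_fst (indicatorConstLp_coeFn (p := 1) (hs := hA) (hμs := hfA) (c := x)),
    ae_prodMeasure_snd (indicatorConstLp_coeFn (p := 1) (hs := hB) (hμs := hfB) (c := y)),
    indicatorConstLp_coeFn (p := 1) (hs := hA.prod hB) (hμs := hAB)
      (c := ((Pop.tmul ι x y : Pop ι E F) : Completion (Pop ι E F)))] with p h1 h2 h3 h4
  rw [h1, h2, h3, h4]
  by_cases hp : p.1 ∈ A <;> by_cases hq : p.2 ∈ B <;>
    simp [Set.indicator, hp, hq, Completion.coe_zero]

/-- An isometry from a complete space has closed range, so it suffices to reach a set with dense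
span: the indicators of sets of finite measure with constant value. -/
theorem surjective_complPopLp : Function.Surjective (complPopLp ι μ ν E F) := by
  let M : Submodule ℂ (Lp (Completion (Pop ι E F)) 1 (prodMeasure μ ν)) :=
    LinearMap.range (complPopLp ι μ ν E F).toLinearMap
  have hM : IsClosed (M : Set (Lp (Completion (Pop ι E F)) 1 (prodMeasure μ ν))) :=
    (isometry_complPopLp (μ := μ) (ν := ν) (E := E) (F := F) ι).isClosedEmbedding.isClosed_range
  have key : ∀ (c : Completion (Pop ι E F)) {S : Set (X × Y)} (hS : MeasurableSet S)
      (hf : prodMeasure μ ν S ≠ ∞), indicatorConstLp 1 hS hf c ∈ M := by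
    intro c S hS hf
    rw [← indicatorLp_apply hS hf]
    -- The condition on `c` is closed and linear, which reduces the constant to an elementary tensor
    -- `x ⊗ y`.
    induction c using Completion.induction_on with
    | hp =>
      refine hM.preimage (AddMonoidHomClass.continuous_of_bound _ ((prodMeasure μ ν).real S)
        fun c => ?_)
      rw [indicatorLp_apply hS hf, norm_indicatorConstLp one_ne_zero ENNReal.one_ne_top]
      simp [mul_comm]
    | ih w =>
      induction w using Pop.induction_on with
      | zero => rw [Completion.coe_zero, map_zero]; exact M.zero_mem
      | add w w' h h' => rw [Completion.coe_add, map_add]; exact M.add_mem h h'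
      | tmul x y =>
        rw [indicatorLp_apply hS hf]
        refine indicatorConstLp_mem_of_rectangles hM ?_ hS hf
        intro A B hA hB hfA hfB hAB
        refine ⟨(Pop.tmul ι (indicatorConstLp 1 hA hfA x) (indicatorConstLp 1 hB hfB y) :
          Pop ι (Lp E 1 μ) (Lp F 1 ν)), ?_⟩
        rw [ContinuousLinearMap.coe_coe, complPopLp_coe, popLp_tmul,
          tensorLp_indicatorConstLp ι hA hB hfA hfB hAB]
  intro f
  change f ∈ M
  induction f using Lp.induction (p := 1) ENNReal.one_ne_top with
  | indicatorConst c hS hf => exact key c hS hf.ne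
  | add hf hg _ h h' => exact M.add_mem h h'
  | isClosed => exact hM

end Isomorphism

end PQ
end
theorem theorem6p9 {L : Type*} [NormedAddCommGroup L] [InnerProductSpace ℂ L] [CompleteSpace L]
    [TopologicalSpace.SeparableSpace L] [Nontrivial L] (hL : ¬ FiniteDimensional ℂ L)
    (ι : Completion (L ⊗[ℂ] L) ≃ₗᵢ[ℂ] L)
    {X Y : Type*} [MeasurableSpace X] [MeasurableSpace Y] (μ : Measure X) (ν : Measure Y)
    {E F : Type*} [NormedAddCommGroup E] [NormedSpace ℂ E] [PQ.PQSpace L E]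
    [NormedAddCommGroup F] [NormedSpace ℂ F] [PQ.PQSpace L F] :
    ∃! I : Completion (PQ.Pop ι (Lp E 1 μ) (Lp F 1 ν)) ≃ₗ[ℂ]
        Lp (Completion (PQ.Pop ι E F)) 1 (PQ.prodMeasure μ ν),
      PQ.IsCompletelyIsometric L I.toLinearMap ∧
      ∀ (x : Lp E 1 μ) (y : Lp F 1 ν),
        I (PQ.Pop.tmul ι x y : PQ.Pop ι (Lp E 1 μ) (Lp F 1 ν)) =ᵐ[PQ.prodMeasure μ ν]
          fun p => ((PQ.Pop.tmul ι (x p.1) (y p.2) : PQ.Pop ι E F) :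
            Completion (PQ.Pop ι E F)) := by
  let φ := PQ.complPopLp ι μ ν E F
  refine ⟨LinearEquiv.ofBijective φ.toLinearMap
    ⟨(PQ.isometry_complPopLp ι).injective, PQ.surjective_complPopLp ι⟩,
    ⟨PQ.isCompletelyIsometric_complPopLp ι, fun x y => ?_⟩, ?_⟩
  · have : φ ((PQ.Pop.tmul ι x y : PQ.Pop ι (Lp E 1 μ) (Lp F 1 ν)) : Completion _) =
        PQ.tensorLp ι μ ν E F x y :=
      (PQ.complPopLp_coe ι _).trans (PQ.popLp_tmul ι x y)
    change (φ _ : X × Y → Completion (PQ.Pop ι E F)) =ᵐ[PQ.prodMeasure μ ν] _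
    rw [this]
    exact PQ.coeFn_tensorLp ι x y
  · rintro J ⟨hJ, hJt⟩
    -- `J` is given only as a linear isomorphism; its continuity comes from complete isometry, and
    -- this lets the comparison on elementary tensors decide.
    have hJi : Isometry J := AddMonoidHomClass.isometry_of_norm J fun z => hJ.norm_map z
    have h : (J : Completion (PQ.Pop ι (Lp E 1 μ) (Lp F 1 ν)) → _) = φ := by
      refine Completion.ext hJi.continuous φ.continuous fun w => ?_
      induction w using PQ.Pop.induction_on with
      | zero => rw [Completion.coe_zero, map_zero, map_zero]
      | add w w' h h' => rw [Completion.coe_add, map_add, map_add, h, h']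
      | tmul x y =>
        rw [PQ.complPopLp_coe, PQ.popLp_tmul]
        ext1
        exact (hJt x y).trans (PQ.coeFn_tensorLp ι x y).symm
    exact LinearEquiv.ext fun z => congrFun h z
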